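/- **Setting.** Let $\chi$ be a finite set of decisions with $|\chi|\ge 2$, let $Y\subset\mathbb{R}^d$ ($d\ge 1$) be bounded with interior $Y^\circ$. For every $x\in\chi$ let $f_x:Y\to\mathbb{R}$ be bounded and Lipschitz with a constant $L_1$, and let $\sigma_x:Y\to(0,\infty)$ be Lipschitz with a constant $L_2$ (both constants independent of $x$). Let $a(x,y)$ be a probability density on $\chi\times Y^\circ$ (counting measure times Lebesgue measure) such that, for every $x$, $a(x,\cdot)$ is strictly positive and continuous on $Y^\circ$. The runs $i=1,2,\dots$ are independent and identically distributed: the pair $(x_{[i]},y_{[i]})$ has density $a$ and, given this pair, one observes $\tilde G_{[i]}=f_{x_{[i]}}(y_{[i]})+\epsilon_{[i]}$ with $\epsilon_{[i]}$ normal of mean $0$ and standard deviation $\sigma_{x_{[i]}}(y_{[i]})$. **Estimator.** Fix $c,\xi>0$ and put $r_m=c\,m^{-\xi/d}$ for $m=1,2,\dots$. For $x\in\chi$, $y\in Y^\circ$ let $b_m^{(t)}(x,y)$ be the set of the runs $i\le t$ with $x_{[i]}=x$, $\|y_{[i]}-y\|<r_m$ and $y_{[i]}\in Y^\circ$. Let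 $\Psi^{(t)}_{x,y}$ be the largest $m\geq 1$ with $|b_m^{(t)}(x,y)|\ge m$ (and $0$ if there is none). If $\Psi=\Psi^{(t)}_{x,y}\ge1$, let $\tau\le t$ be the first stage with $|b_{\Psi}^{(\tau)}(x,y)|=\Psi$, and let $$\hat f^{(t)}_x(y)=\frac1{\Psi}\sum_{i\in b_{\Psi}^{(\tau)}(x,y)}\tilde G_{[i]} .$$ Let $\hat x^{(t)}(y)$ be a random decision that minimizes $x\mapsto \hat f_x^{(t)}(y)$ (ties broken arbitrarily, possibly at random; the choice is arbitrary as long as some of these estimates does not exist). For a metric $\rho$ on $\mathbb{R}$ and a context $y$ with optimal decision $x^*=x^*(y)$, let $$\upsilon^{(t)}(y)=E\,\rho\big(f_{\hat x^{(t)}(y)}(y),f_{x^*}(y)\big).$$ **Theorem.** For every $y\in Y^\circ$ at which the minimizer $x^*=x^*(y)$ of $x\mapsto f_x(y)$ is unique, $\upsilon^{(t)}(y)\to0$ as $t\to\infty$, and $$\liminf_{t\to\infty}\,-\frac{1}{t^{1/(1+\xi)}}\ln\upsilon^{(t)}(y)\;\ge\;H'_y>0$$ (with $-\ln 0=+\infty$),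 where $$H'_y=C^{\frac1{1+\xi}}\min_{x\in\chi}\Big\{\zeta_x(y)\,\big(-W_{-1}(-e^{-\zeta_x(y)-1})\big)^{-\frac1{1+\xi}}\,a(x,y)^{\frac1{1+\xi}}\Big\},\qquad C=\frac{\pi^{d/2}}{\Gamma(\frac d2+1)}\,c^d,$$ $$\zeta_x(y)=\begin{cases}\dfrac{(f_x(y)-f_{x^*}(y))^2}{4\sigma_x^2(y)} & x\ne x^*,\\[2ex] \dfrac{\big(\min_{x'\neq x^*}f_{x'}(y)-f_{x^*}(y)\big)^2}{4\sigma_{x^*}^2(y)} & x=x^*,\end{cases}$$ and $W_{-1}$ is the lower branch of the Lambert function: for $-e^{-1}\le z<0$, $W_{-1}(z)$ is the unique $w\le-1$ with $we^w=z$. -/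

import Mathlib

open MeasureTheory ProbabilityTheory Filter Topology
open scoped NNReal ENNReal

noncomputable section

namespace SNE

variable {χ : Type*} {d : ℕ}

/-! ## Neighborhood sets and the shrinking neighborhood estimator

A data set is given by the sequence of sampled decisions `X : ℕ → χ`, the sequence of sampled
contexts `V : ℕ → EuclideanSpace ℝ (Fin d)` and the sequence of observations `G : ℕ → ℝ`.
At stage `t` the runs with index `0, …, t - 1` are available. -/

/-- The radius `r_m = c m ^ (-ξ / d)`, `m = 1, 2, …`. -/
def radius (d : ℕ) (c ξ : ℝ) (m : ℕ) : ℝ := c * (m : ℝ) ^ (-ξ / (d : ℝ))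

open Classical in
/-- The (indices of the) samples among the first `t` runs that use the decision `x`, and whose
context lies in the interior of `Y` and at distance less than `r` from `y`. -/
def localSamples (Y : Set (EuclideanSpace ℝ (Fin d))) (X : ℕ → χ)
    (V : ℕ → EuclideanSpace ℝ (Fin d)) (t : ℕ) (x : χ) (y : EuclideanSpace ℝ (Fin d)) (r : ℝ) :
    Finset ℕ :=
  (Finset.range t).filter fun i => X i = x ∧ ‖V i - y‖ < r ∧ V i ∈ interior Y

/-- The `m`-set of `(x, y)` on stage `t`. -/
def mSet (Y : Set (EuclideanSpace ℝ (Fin d))) (c ξ : ℝ) (X : ℕ → χ)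
    (V : ℕ → EuclideanSpace ℝ (Fin d)) (t : ℕ) (x : χ) (y : EuclideanSpace ℝ (Fin d)) (m : ℕ) :
    Finset ℕ :=
  localSamples Y X V t x y (radius d c ξ m)

/-- The first stage `t' ≤ t` at which the `m`-set has exactly `m` elements. It is only used for
`m`-sets that are activated on stage `t`, that is, have at least `m` elements then. -/
def activationTime (Y : Set (EuclideanSpace ℝ (Fin d))) (c ξ : ℝ) (X : ℕ → χ)
    (V : ℕ → EuclideanSpace ℝ (Fin d)) (t : ℕ) (x : χ) (y : EuclideanSpace ℝ (Fin d)) (m : ℕ) :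
    ℕ :=
  sInf {t' : ℕ | t' ≤ t ∧ (mSet Y c ξ X V t' x y m).card = m}

/-- The largest `m` whose `m`-set is activated on stage `t` (such an `m` is at most `t`); the value
is `0` if no `m`-set with `m ≥ 1` is activated. -/
def Psi (Y : Set (EuclideanSpace ℝ (Fin d))) (c ξ : ℝ) (X : ℕ → χ)
    (V : ℕ → EuclideanSpace ℝ (Fin d)) (t : ℕ) (x : χ) (y : EuclideanSpace ℝ (Fin d)) : ℕ :=
  Nat.findGreatest (fun m => m ≤ (mSet Y c ξ X V t x y m).card) t

/-- The neighborhood samples of `(x, y)` on stage `t`: the activated `m`-set with the largest `m`,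
frozen at the stage of its activation. -/
def neighborhood (Y : Set (EuclideanSpace ℝ (Fin d))) (c ξ : ℝ) (X : ℕ → χ)
    (V : ℕ → EuclideanSpace ℝ (Fin d)) (t : ℕ) (x : χ) (y : EuclideanSpace ℝ (Fin d)) :
    Finset ℕ :=
  mSet Y c ξ X V (activationTime Y c ξ X V t x y (Psi Y c ξ X V t x y)) x y
    (Psi Y c ξ X V t x y)

/-- The shrinking neighborhood estimate of the performance of `x` at `y` on stage `t`. It is
meaningful when `Psi ≥ 1`. -/
def estimate (Y : Set (EuclideanSpace ℝ (Fin d))) (c ξ : ℝ) (X : ℕ → χ)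
    (V : ℕ → EuclideanSpace ℝ (Fin d)) (G : ℕ → ℝ) (t : ℕ) (x : χ)
    (y : EuclideanSpace ℝ (Fin d)) : ℝ :=
  (∑ i ∈ neighborhood Y c ξ X V t x y, G i) / (Psi Y c ξ X V t x y : ℝ)

/-! ## The random experiment -/

/-- Static random sampling with Gaussian noise. The runs `(X i, V i, ε i)` are independent; in each
of them the pair (decision, context) has density `a` on `χ ×` interior of `Y`, and, given that
`(x, y)` is sampled, the noise is normal with mean `0` and standard deviation `σ x y`. -/
structure IsStaticSampling {Ω : Type*} [MeasurableSpace Ω] [MeasurableSpace χ] (P : Measure Ω)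
    (Y : Set (EuclideanSpace ℝ (Fin d))) (a σ : χ → EuclideanSpace ℝ (Fin d) → ℝ)
    (X : ℕ → Ω → χ) (V : ℕ → Ω → EuclideanSpace ℝ (Fin d)) (ε : ℕ → Ω → ℝ) : Prop where
  measurable_decision : ∀ i, Measurable (X i)
  measurable_context : ∀ i, Measurable (V i)
  measurable_noise : ∀ i, Measurable (ε i)
  indep : iIndepFun (fun i ω => (X i ω, V i ω, ε i ω)) P
  law : ∀ (i : ℕ) (x : χ) (B : Set (EuclideanSpace ℝ (Fin d))) (S : Set ℝ),
    MeasurableSet B → MeasurableSet S →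
      P {ω | X i ω = x ∧ V i ω ∈ B ∧ ε i ω ∈ S} =
        ∫⁻ y in B ∩ interior Y,
          ENNReal.ofReal (a x y) * gaussianReal 0 (Real.toNNReal (σ x y ^ 2)) S

/-- The data-driven decisions `xhat t y`: random variables that minimize the estimated performance
at `y` on stage `t` as soon as all these estimates exist. Ties are broken in an arbitrary
(possibly random) way. -/
structure IsEstimatedOptimum {Ω : Type*} [MeasurableSpace Ω] [MeasurableSpace χ]
    (Y : Set (EuclideanSpace ℝ (Fin d))) (c ξ : ℝ) (f : χ → EuclideanSpace ℝ (Fin d) → ℝ)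
    (X : ℕ → Ω → χ) (V : ℕ → Ω → EuclideanSpace ℝ (Fin d)) (ε : ℕ → Ω → ℝ)
    (xhat : ℕ → EuclideanSpace ℝ (Fin d) → Ω → χ) : Prop where
  measurable : ∀ t y, Measurable (xhat t y)
  minimizes : ∀ (t : ℕ), ∀ y ∈ interior Y, ∀ ω : Ω,
    (∀ x, 1 ≤ Psi Y c ξ (fun i => X i ω) (fun i => V i ω) t x y) →
      ∀ x,
        estimate Y c ξ (fun i => X i ω) (fun i => V i ω)
            (fun i => f (X i ω) (V i ω) + ε i ω) t (xhat t y ω) y ≤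
          estimate Y c ξ (fun i => X i ω) (fun i => V i ω)
            (fun i => f (X i ω) (V i ω) + ε i ω) t x y

/-- `ρ` is a metric on the real line. -/
structure IsMetric (ρ : ℝ → ℝ → ℝ) : Prop where
  eq_zero_iff : ∀ u v, ρ u v = 0 ↔ u = v
  symm : ∀ u v, ρ u v = ρ v u
  triangle : ∀ u v w, ρ u w ≤ ρ u v + ρ v w

/-- The expected decision loss at `y` of a random decision `D`, when `xs` is optimal at `y`. -/
def expectedLoss {Ω : Type*} [MeasurableSpace Ω] (P : Measure Ω) (ρ : ℝ → ℝ → ℝ)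
    (f : χ → EuclideanSpace ℝ (Fin d) → ℝ) (D : Ω → χ) (xs : χ)
    (y : EuclideanSpace ℝ (Fin d)) : ℝ≥0∞ :=
  ∫⁻ ω, ENNReal.ofReal (ρ (f (D ω) y) (f xs y)) ∂P

/-! ## The rate -/

/-- The lower branch of the Lambert function: for `-e⁻¹ ≤ z < 0` it is the unique `w ≤ -1` with
`w * exp w = z`. -/
def lambertWNegOne (z : ℝ) : ℝ := sInf {w : ℝ | w ≤ -1 ∧ w * Real.exp w = z}

/-- The constant `C = π ^ (d / 2) / Γ(d / 2 + 1) * c ^ d`. -/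
def volConst (d : ℕ) (c : ℝ) : ℝ :=
  Real.pi ^ ((d : ℝ) / 2) / Real.Gamma ((d : ℝ) / 2 + 1) * c ^ d

open Classical in
/-- The quantity `ζ_x(y)`, where `xs` is the unique optimal decision at `y`. -/
def zeta (f σ : χ → EuclideanSpace ℝ (Fin d) → ℝ) (xs : χ) (y : EuclideanSpace ℝ (Fin d))
    (x : χ) : ℝ :=
  if x = xs then ((⨅ x' : {x' : χ // x' ≠ xs}, f x' y) - f xs y) ^ 2 / (4 * σ xs y ^ 2)
  else (f x y - f xs y) ^ 2 / (4 * σ x y ^ 2)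

/-- The rate `H'_y`. -/
def rate (c ξ : ℝ) (f σ a : χ → EuclideanSpace ℝ (Fin d) → ℝ) (xs : χ)
    (y : EuclideanSpace ℝ (Fin d)) : ℝ :=
  volConst d c ^ (1 / (1 + ξ)) *
    ⨅ x : χ, zeta f σ xs y x *
      (-lambertWNegOne (-Real.exp (-zeta f σ xs y x - 1))) ^ (-(1 / (1 + ξ))) *
      a x y ^ (1 / (1 + ξ))

end SNE

end

namespace SNE

/-! ## Independence and concentration -/

/-! Put `τ = t ^ (1 / (1 + ξ))` and give each decision `x` a cutoff `k_x ≈ s_x τ`. A wrong decision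
forces one of two events: some `Psi` stays below its cutoff, or all cutoffs are reached and some `x
≠ xs` still looks at least as good as `xs`.

For the first event, about `t · a(x,y) · C k_x ^ (-ξ)` runs fall into the ball of radius `r_{k_x}`,
a number of the same order `τ` as `k_x`. If `u` is the ratio of this number to `k_x`, the optimized
Chernoff bound has exponent `s_x (u - 1 - log u) τ` (`measure_Psi_lt_le`).

For the second event, the sets of runs that are averaged depend only on decisions and contexts,
which are independent of the standardized noise (`indepFun_decision_context_stdNoise`). With these
frozen, the difference of two estimates is a Gaussian sum with vanishing bias and variance at most
about `σ_x² / k_x + σ_xs² / k_xs`. This gives a Gaussian tail (`measure_estimate_le_le`).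

Now choose `s_x` so that `u - 1 - log u = ζ_x`, that is, `u = -W₋₁(-exp (-ζ_x - 1))`. The activation
exponent becomes `ζ_x s_x`, which is the term of `x` in the rate (`rate_eq`), and the Gaussian
exponent is no smaller than the lesser of `ζ_x s_x` and `ζ_xs s_xs` (`lt_error_exponent`). A union
bound over the finite `χ` costs only a constant factor, and the loss is at most a constant times the
probability of error. -/

theorem comap_pi_eq_iSup {Ω γ : Type*} [MeasurableSpace γ] (F : ℕ → Ω → γ) :
    MeasurableSpace.comap (fun ω i => F i ω) MeasurableSpace.pi =
      ⨆ i ∈ (Set.univ : Set ℕ), MeasurableSpace.comap (F i) inferInstance := by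
  simp [MeasurableSpace.pi, MeasurableSpace.comap_iSup, MeasurableSpace.comap_comp,
    Function.comp_def]

/-- If the pairs `(Z i, H i)` are independent and `Z i` is independent of `H i` for each `i`, then
the whole sequence `Z` is independent of the whole sequence `H`. -/
theorem indepFun_pi_of_iIndepFun_prodMk {Ω α β : Type*} [MeasurableSpace Ω] [MeasurableSpace α]
    [MeasurableSpace β] {P : Measure Ω} [IsProbabilityMeasure P] {Z : ℕ → Ω → α} {H : ℕ → Ω → β}
    (hZ : ∀ i, Measurable (Z i)) (hH : ∀ i, Measurable (H i))
    (h : iIndepFun (fun i ω => (Z i ω, H i ω)) P) (hi : ∀ i, IndepFun (Z i) (H i) P) :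
    IndepFun (fun ω i => Z i ω) (fun ω i => H i ω) P := by
  classical
  have key : ∀ (S : Finset ℕ) (A : ℕ → Set α) (B : ℕ → Set β), (∀ i, MeasurableSet (A i)) →
      (∀ i, MeasurableSet (B i)) →
      P (⋂ i ∈ S, Z i ⁻¹' A i ∩ H i ⁻¹' B i) =
        (∏ i ∈ S, P (Z i ⁻¹' A i)) * ∏ i ∈ S, P (H i ⁻¹' B i) := by
    intro S A B hA hB
    have := h.measure_inter_preimage_eq_mul S (sets := fun i => A i ×ˢ B i)
      (fun i _ => (hA i).prod (hB i))
    have e : ∀ i, (fun ω => (Z i ω, H i ω)) ⁻¹' (A i ×ˢ B i) = Z i ⁻¹' A i ∩ H i ⁻¹' B i := by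
      intro i; ext ω; simp
    simp only [e] at this
    rw [this, ← Finset.prod_mul_distrib]
    exact Finset.prod_congr rfl fun i _ =>
      (hi i).measure_inter_preimage_eq_mul _ _ (hA i) (hB i)
  rw [IndepFun_iff_Indep]
  -- Finite intersections of coordinate events form π-systems that generate the two σ-algebras, so
  -- only the product formula on them remains.
  refine IndepSets.indep
    (p1 := piiUnionInter (fun i => {s | MeasurableSet[MeasurableSpace.comap (Z i) inferInstance] s})
      Set.univ)
    (p2 := piiUnionInter (fun i => {s | MeasurableSet[MeasurableSpace.comap (H i) inferInstance] s})
      Set.univ)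
    (measurable_pi_iff.2 hZ).comap_le (measurable_pi_iff.2 hH).comap_le
    (isPiSystem_piiUnionInter _ (fun i => @MeasurableSpace.isPiSystem_measurableSet _ (_)) _)
    (isPiSystem_piiUnionInter _ (fun i => @MeasurableSpace.isPiSystem_measurableSet _ (_)) _)
    ((comap_pi_eq_iSup Z).trans (generateFrom_piiUnionInter_measurableSet _ _).symm)
    ((comap_pi_eq_iSup H).trans (generateFrom_piiUnionInter_measurableSet _ _).symm) ?_
  rw [IndepSets_iff]
  rintro _ _ ⟨S, -, a, ha, rfl⟩ ⟨T, -, b, hb, rfl⟩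
  -- Padding with `univ` off `S` and off `T` lets both finite families be indexed by `S ∪ T`, where
  -- `key` applies.
  have ha' : ∀ i, ∃ A : Set α, MeasurableSet A ∧ (i ∈ S → Z i ⁻¹' A = a i) ∧
      (i ∉ S → A = Set.univ) := by
    intro i
    by_cases hiS : i ∈ S
    · obtain ⟨A, hA, e⟩ := ha i hiS
      exact ⟨A, hA, fun _ => e, fun h => absurd hiS h⟩
    · exact ⟨Set.univ, MeasurableSet.univ, fun h => absurd h hiS, fun _ => rfl⟩
  have hb' : ∀ i, ∃ B : Set β, MeasurableSet B ∧ (i ∈ T → H i ⁻¹' B = b i) ∧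
      (i ∉ T → B = Set.univ) := by
    intro i
    by_cases hiS : i ∈ T
    · obtain ⟨A, hA, e⟩ := hb i hiS
      exact ⟨A, hA, fun _ => e, fun h => absurd hiS h⟩
    · exact ⟨Set.univ, MeasurableSet.univ, fun h => absurd h hiS, fun _ => rfl⟩
  choose A hA hAS hAu using ha'
  choose B hB hBT hBu using hb'
  have e1 : (⋂ i ∈ S, a i) = ⋂ i ∈ S ∪ T, Z i ⁻¹' A i ∩ H i ⁻¹' Set.univ := by
    ext ω
    simp only [Set.mem_iInter, Set.preimage_univ, Set.inter_univ, Finset.mem_union]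
    constructor
    · intro h i _
      by_cases hiS : i ∈ S
      · rw [hAS i hiS]; exact h i hiS
      · rw [hAu i hiS]; trivial
    · intro h i hiS
      rw [← hAS i hiS]; exact h i (Or.inl hiS)
  have e2 : (⋂ i ∈ T, b i) = ⋂ i ∈ S ∪ T, Z i ⁻¹' Set.univ ∩ H i ⁻¹' B i := by
    ext ω
    simp only [Set.mem_iInter, Set.preimage_univ, Set.univ_inter, Finset.mem_union]
    constructor
    · intro h i _
      by_cases hiS : i ∈ T
      · rw [hBT i hiS]; exact h i hiS
      · rw [hBu i hiS]; trivial
    · intro h i hiS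
      rw [← hBT i hiS]; exact h i (Or.inr hiS)
  have e3 : (⋂ i ∈ S, a i) ∩ (⋂ i ∈ T, b i) = ⋂ i ∈ S ∪ T, Z i ⁻¹' A i ∩ H i ⁻¹' B i := by
    rw [e1, e2]
    ext ω
    simp only [Set.mem_inter_iff, Set.mem_iInter, Set.preimage_univ, Set.univ_inter,
      Set.inter_univ]
    exact ⟨fun h i hi => ⟨h.1 i hi, h.2 i hi⟩, fun h => ⟨fun i hi => (h i hi).1,
      fun i hi => (h i hi).2⟩⟩
  rw [e3, e1, e2, key _ A B hA hB, key _ A _ hA (fun _ => MeasurableSet.univ),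
    key _ _ B (fun _ => MeasurableSet.univ) hB]
  simp

/-- Gaussian tail bound for a linear combination of independent standard normal variables. -/
theorem measureReal_sum_le_neg_of_gaussian {Ω : Type*} [MeasurableSpace Ω] {P : Measure Ω}
    [IsProbabilityMeasure P] {H : ℕ → Ω → ℝ} (hind : iIndepFun H P)
    (hlaw : ∀ i, P.map (H i) = gaussianReal 0 1) (s : Finset ℕ) (w : ℕ → ℝ) {v Δ : ℝ}
    (hΔ : 0 ≤ Δ) (hw : ∑ i ∈ s, w i ^ 2 ≤ v) :
    P.real {ω | ∑ i ∈ s, w i * H i ω ≤ -Δ} ≤ Real.exp (-Δ ^ 2 / (2 * v)) := by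
  have hsub : ∀ i, HasSubgaussianMGF (H i) 1 P := fun i => by
    have hm : AEMeasurable (H i) P := aemeasurable_of_map_neZero (by rw [hlaw i]; infer_instance)
    refine ⟨fun t => ?_, fun t => ?_⟩
    · rw [← mgf_pos_iff, mgf_gaussianReal (hlaw i)]; positivity
    · rw [mgf_gaussianReal (hlaw i)]; simp
  have h1 := HasSubgaussianMGF.measure_sum_ge_le_of_iIndepFun (s := s)
    (hind.comp (fun i z => (-w i) * z) (fun i => by fun_prop))
    (fun i _ => (hsub i).const_mul (-w i)) hΔ
  have e : {ω | Δ ≤ ∑ i ∈ s, ((fun z => (-w i) * z) ∘ H i) ω} =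
      {ω | ∑ i ∈ s, w i * H i ω ≤ -Δ} := by
    ext ω
    simp only [Function.comp, Set.mem_ofPred_eq, neg_mul, Finset.sum_neg_distrib]
    exact ⟨fun h => by linarith, fun h => by linarith⟩
  rw [e] at h1
  -- If all coefficients vanish, the exponent in `h1` is a division by zero and says nothing; but
  -- then the sum is `0`, and the event is empty unless `Δ = 0`, when the bound is `1`.
  rcases eq_or_lt_of_le (Finset.sum_nonneg (s := s) fun i _ => sq_nonneg (w i)) with h0 | h0
  · have hz : ∀ i ∈ s, w i = 0 := fun i hi => by
      have := (Finset.sum_eq_zero_iff_of_nonneg (fun i _ => sq_nonneg (w i))).1 h0.symm i hi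
      simpa using this
    rcases eq_or_lt_of_le hΔ with hd | hd
    · subst hd; simp
    · have : {ω | ∑ i ∈ s, w i * H i ω ≤ -Δ} = ∅ := by
        ext ω
        have : ∑ i ∈ s, w i * H i ω = 0 := Finset.sum_eq_zero fun i hi => by simp [hz i hi]
        simp [this, hd]
      rw [this]; simpa using (Real.exp_pos _).le
  · refine h1.trans (Real.exp_le_exp.2 ?_)
    rw [neg_div, neg_div, neg_le_neg_iff]
    refine (div_le_div_of_nonneg_left (sq_nonneg _) (by positivity)
      (by linarith : 2 * (∑ i ∈ s, w i ^ 2) ≤ 2 * v)).trans (le_of_eq ?_)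
    rw [NNReal.coe_sum]
    congr 2
    refine Finset.sum_congr rfl fun i _ => ?_
    change w i ^ 2 = (-w i) ^ 2 * 1
    ring

/-- Gaussian tail bound for a linear combination with random coefficients that are independent of
the standard normal variables. -/
theorem measure_sum_le_neg_of_indepFun {Ω α : Type*} [MeasurableSpace Ω] [MeasurableSpace α]
    {P : Measure Ω} [IsProbabilityMeasure P] {Z : Ω → α} {H : ℕ → Ω → ℝ} (hZ : Measurable Z)
    (hH : ∀ i, Measurable (H i)) (hZH : IndepFun Z (fun ω i => H i ω) P) (hind : iIndepFun H P)
    (hlaw : ∀ i, P.map (H i) = gaussianReal 0 1) (s : Finset ℕ) {w : ℕ → α → ℝ}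
    (hwm : ∀ i, Measurable (w i)) {A : Set α} (hA : MeasurableSet A) {v Δ : ℝ}
    (hΔ : 0 ≤ Δ) (hw : ∀ z ∈ A, ∑ i ∈ s, w i z ^ 2 ≤ v) :
    P {ω | Z ω ∈ A ∧ ∑ i ∈ s, w i (Z ω) * H i ω ≤ -Δ} ≤
      ENNReal.ofReal (Real.exp (-Δ ^ 2 / (2 * v))) := by
  have hHm : Measurable (fun ω i => H i ω) := measurable_pi_iff.2 hH
  set E : Set (α × (ℕ → ℝ)) := {q | q.1 ∈ A ∧ ∑ i ∈ s, w i q.1 * q.2 i ≤ -Δ} with hE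
  have hEm : MeasurableSet E := by
    have hm : Measurable fun q : α × (ℕ → ℝ) => ∑ i ∈ s, w i q.1 * q.2 i := ?_
    · exact (measurable_fst hA).inter (measurableSet_le hm measurable_const)
    refine Finset.measurable_sum _ fun i _ => ?_
    exact ((hwm i).comp measurable_fst).mul ((measurable_pi_apply i).comp measurable_snd)
  have e : {ω | Z ω ∈ A ∧ ∑ i ∈ s, w i (Z ω) * H i ω ≤ -Δ} =
      (fun ω => (Z ω, fun i => H i ω)) ⁻¹' E := rfl
  rw [e, ← Measure.map_apply (hZ.prodMk hHm) hEm,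
    (indepFun_iff_map_prod_eq_prod_map_map hZ.aemeasurable hHm.aemeasurable).1 hZH,
    Measure.prod_apply hEm]
  have : IsProbabilityMeasure (P.map Z) := Measure.isProbabilityMeasure_map hZ.aemeasurable
  -- By Fubini it suffices to bound each section: for `z ∈ A` the coefficients are constants, and
  -- for `z ∉ A` the section is empty.
  calc _ ≤ ∫⁻ _, ENNReal.ofReal (Real.exp (-Δ ^ 2 / (2 * v))) ∂(P.map Z) := by
        refine lintegral_mono fun z => ?_
        rw [Measure.map_apply hHm (measurable_prodMk_left hEm)]
        by_cases hz : z ∈ A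
        · have := measureReal_sum_le_neg_of_gaussian hind hlaw s (fun i => w i z) hΔ (hw z hz)
          rw [← ENNReal.ofReal_le_ofReal_iff (Real.exp_pos _).le, ofReal_measureReal] at this
          refine (measure_mono ?_).trans this
          intro ω hω
          exact hω.2
        · refine le_trans (le_of_eq ?_) zero_le
          convert measure_empty (μ := P)
          ext ω
          simp [hE, hz]
    _ = _ := by simp

open Classical in
/-- Chernoff bound for the lower tail of the number of successes in independent trials. -/
theorem measure_card_filter_le {Ω α : Type*} [MeasurableSpace Ω] [MeasurableSpace α]
    {P : Measure Ω} [IsProbabilityMeasure P] {Z : ℕ → Ω → α} (hZ : ∀ i, Measurable (Z i))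
    (hind : iIndepFun Z P) {S : Set α} (hS : MeasurableSet S) {p : ℝ}
    (hp : ∀ i, p ≤ P.real (Z i ⁻¹' S)) {θ : ℝ} (hθ : 0 ≤ θ) (t : ℕ) (k : ℝ) :
    P {ω | (((Finset.range t).filter fun i => Z i ω ∈ S).card : ℝ) ≤ k} ≤
      ENNReal.ofReal (Real.exp (-(t * p * (1 - Real.exp (-θ)) - k * θ))) := by
  set I : ℕ → Ω → ℝ := fun i => (S.indicator fun _ => (1 : ℝ)) ∘ Z i with hI
  have hφ : Measurable (S.indicator fun _ => (1 : ℝ)) := measurable_const.indicator hS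
  have hIm : ∀ i, Measurable (I i) := fun i => hφ.comp (hZ i)
  have hIind : iIndepFun I P := hind.comp _ fun _ => hφ
  have hcard : ∀ ω, (((Finset.range t).filter fun i => Z i ω ∈ S).card : ℝ) =
      (∑ i ∈ Finset.range t, I i) ω := by
    intro ω
    rw [Finset.sum_apply, Finset.card_filter]
    push_cast
    refine Finset.sum_congr rfl fun i _ => ?_
    simp [hI, Set.indicator_apply]
  have hmgf : ∀ i, mgf (I i) P (-θ) ≤ Real.exp (-(p * (1 - Real.exp (-θ)))) := by
    intro i
    -- Since `I i` takes only the values `0` and `1`, the exponential is affine in the indicator;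
    -- its mean is at most `1 - p (1 - exp (-θ))`, and `1 + r ≤ exp r` finishes.
    have e : (fun ω => Real.exp (-θ * I i ω)) = fun ω =>
        1 - (1 - Real.exp (-θ)) * (Z i ⁻¹' S).indicator (fun _ => (1 : ℝ)) ω := by
      ext ω
      by_cases h : Z i ω ∈ S <;> simp [hI, h]
    have hm : MeasurableSet (Z i ⁻¹' S) := hZ i hS
    have hint : Integrable ((Z i ⁻¹' S).indicator (fun _ => (1 : ℝ))) P :=
      (integrable_const 1).indicator hm
    rw [mgf, e, integral_sub (integrable_const _) (hint.const_mul _), integral_const_mul,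
      integral_indicator hm]
    simp only [integral_const, smul_eq_mul, mul_one, measureReal_restrict_apply_univ]
    have h1 : 0 ≤ 1 - Real.exp (-θ) := by
      have := Real.exp_le_one_iff.2 (neg_nonpos.2 hθ); linarith
    have h2 := Real.add_one_le_exp (-(p * (1 - Real.exp (-θ))))
    have h3 := mul_le_mul_of_nonneg_left (hp i) h1
    simp only [probReal_univ]
    linarith
  have hsum : mgf (∑ i ∈ Finset.range t, I i) P (-θ) ≤
      Real.exp (-(t * p * (1 - Real.exp (-θ)))) := by
    rw [hIind.mgf_sum hIm]
    refine (Finset.prod_le_prod (fun i _ => mgf_nonneg) fun i _ => hmgf i).trans (le_of_eq ?_)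
    rw [Finset.prod_const, Finset.card_range, ← Real.exp_nat_mul]
    ring_nf
  have hnn : ∀ ω, 0 ≤ (∑ i ∈ Finset.range t, I i) ω := fun ω => by
    rw [← hcard]; positivity
  have hint : Integrable (fun ω => Real.exp (-θ * (∑ i ∈ Finset.range t, I i) ω)) P := by
    refine Integrable.of_bound (C := 1) ?_ (ae_of_all _ fun ω => ?_)
    · have : Measurable (∑ i ∈ Finset.range t, I i) :=
        by fun_prop
      exact ((this.const_mul _).exp).aestronglyMeasurable
    · rw [Real.norm_of_nonneg (Real.exp_pos _).le, Real.exp_le_one_iff]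
      nlinarith [hnn ω]
  have hfin := measure_le_le_exp_mul_mgf (μ := P) k (neg_nonpos.2 hθ) hint
  simp only [hcard]
  rw [← ofReal_measureReal]
  refine ENNReal.ofReal_le_ofReal (hfin.trans ?_)
  refine (mul_le_mul_of_nonneg_left hsum (Real.exp_pos _).le).trans (le_of_eq ?_)
  rw [← Real.exp_add]
  ring_nf

end SNE

namespace SNE

/-! ## Standardized noise -/

section Sampling

set_option linter.unusedSectionVars false

variable {χ : Type*} {d : ℕ}

open Classical in
/-- The standard deviation of the noise, continued by `1` outside the interior of `Y`. -/
noncomputable def scale (Y : Set (EuclideanSpace ℝ (Fin d)))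
    (σ : χ → EuclideanSpace ℝ (Fin d) → ℝ) (q : χ × EuclideanSpace ℝ (Fin d)) : ℝ :=
  (interior Y).piecewise (σ q.1) (fun _ => 1) q.2

/-- The noise of the `i`-th run divided by its standard deviation. -/
noncomputable def stdNoise {Ω : Type*} (Y : Set (EuclideanSpace ℝ (Fin d)))
    (σ : χ → EuclideanSpace ℝ (Fin d) → ℝ) (X : ℕ → Ω → χ)
    (V : ℕ → Ω → EuclideanSpace ℝ (Fin d)) (ε : ℕ → Ω → ℝ) (i : ℕ) (ω : Ω) : ℝ :=
  ε i ω / scale Y σ (X i ω, V i ω)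

variable {Y : Set (EuclideanSpace ℝ (Fin d))} {σ a : χ → EuclideanSpace ℝ (Fin d) → ℝ}

theorem scale_of_mem {x : χ} {v : EuclideanSpace ℝ (Fin d)} (hv : v ∈ interior Y) :
    scale Y σ (x, v) = σ x v := by
  simp [scale, hv]

theorem scale_pos (hσ : ∀ x, ∀ y ∈ interior Y, 0 < σ x y)
    (q : χ × EuclideanSpace ℝ (Fin d)) : 0 < scale Y σ q := by
  by_cases h : q.2 ∈ interior Y
  · simpa [scale, h] using hσ q.1 q.2 h
  · simp [scale, h]

theorem measurable_scale_apply (hσc : ∀ x, ContinuousOn (σ x) (interior Y)) (x : χ) :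
    Measurable fun v => scale Y σ (x, v) := by
  classical
  exact (hσc x).measurable_piecewise continuousOn_const isOpen_interior.measurableSet

variable [Finite χ] [MeasurableSpace χ] [MeasurableSingletonClass χ]

theorem measurable_scale (hσc : ∀ x, ContinuousOn (σ x) (interior Y)) :
    Measurable (scale Y σ) :=
  measurable_from_prod_countable_right fun x => measurable_scale_apply hσc x

variable {Ω : Type*} [MeasurableSpace Ω] {P : Measure Ω} [IsProbabilityMeasure P]
  {X : ℕ → Ω → χ} {V : ℕ → Ω → EuclideanSpace ℝ (Fin d)} {ε : ℕ → Ω → ℝ}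

namespace IsStaticSampling

theorem measure_decision_context (hs : IsStaticSampling P Y a σ X V ε) (i : ℕ) (x : χ)
    {B : Set (EuclideanSpace ℝ (Fin d))} (hB : MeasurableSet B) :
    P {ω | X i ω = x ∧ V i ω ∈ B} = ∫⁻ y in B ∩ interior Y, ENNReal.ofReal (a x y) := by
  simpa using hs.law i x B Set.univ hB MeasurableSet.univ

/-- On the event that `x` is sampled, the context and the noise have the law of
`(v, σ x v * e)`, where `v` has density `a x` and `e` is standard normal. -/
theorem map_context_noise (hs : IsStaticSampling P Y a σ X V ε)
    (hσc : ∀ x, ContinuousOn (σ x) (interior Y)) (hac : ∀ x, ContinuousOn (a x) (interior Y))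
    (i : ℕ) (x : χ) :
    (P.restrict {ω | X i ω = x}).map (fun ω => (V i ω, ε i ω)) =
      (((volume.restrict (interior Y)).withDensity fun y => ENNReal.ofReal (a x y)).prod
        (gaussianReal 0 1)).map (fun q => (q.1, scale Y σ (x, q.1) * q.2)) := by
  have hsm := measurable_scale_apply (Y := Y) hσc x
  have hmap : Measurable fun q : EuclideanSpace ℝ (Fin d) × ℝ =>
      (q.1, scale Y σ (x, q.1) * q.2) :=
    measurable_fst.prodMk ((hsm.comp measurable_fst).mul measurable_snd)
  have hVε : Measurable fun ω => (V i ω, ε i ω) :=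
    (hs.measurable_context i).prodMk (hs.measurable_noise i)
  have hX : MeasurableSet {ω | X i ω = x} := hs.measurable_decision i (measurableSet_singleton x)
  have ham : AEMeasurable (fun y => ENNReal.ofReal (a x y)) (volume.restrict (interior Y)) :=
    ((hac x).aemeasurable isOpen_interior.measurableSet).ennreal_ofReal
  refine Measure.ext_prod fun {B S} hB hS => ?_
  rw [Measure.map_apply hVε (hB.prod hS), Measure.restrict_apply (hVε (hB.prod hS)),
    Measure.map_apply hmap (hB.prod hS), Measure.prod_apply (hmap (hB.prod hS))]
  have e : (fun ω => (V i ω, ε i ω)) ⁻¹' B ×ˢ S ∩ {ω | X i ω = x} =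
      {ω | X i ω = x ∧ V i ω ∈ B ∧ ε i ω ∈ S} := by
    ext ω; simp; tauto
  rw [e, hs.law i x B S hB hS, lintegral_withDensity_eq_lintegral_mul₀ ham
    (measurable_measure_prodMk_left (hmap (hB.prod hS))).aemeasurable,
    ← setLIntegral_indicator hB]
  refine setLIntegral_congr_fun isOpen_interior.measurableSet fun v hv => ?_
  by_cases hvB : v ∈ B
  · simp only [Set.indicator_of_mem hvB, Pi.mul_apply]
    congr 1
    have e2 : Prod.mk v ⁻¹' ((fun q : EuclideanSpace ℝ (Fin d) × ℝ =>
        (q.1, scale Y σ (x, q.1) * q.2)) ⁻¹' B ×ˢ S) = (σ x v * ·) ⁻¹' S := by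
      ext r; simp [hvB, scale_of_mem hv]
    rw [e2, ← Measure.map_apply (measurable_const_mul _) hS, gaussianReal_map_const_mul]
    congr 2
    · simp
    · ext; simp [sq_nonneg]
  · have e2 : Prod.mk v ⁻¹' ((fun q : EuclideanSpace ℝ (Fin d) × ℝ =>
        (q.1, scale Y σ (x, q.1) * q.2)) ⁻¹' B ×ˢ S) = ∅ := by
      ext r; simp [hvB]
    simp only [Set.indicator_of_notMem hvB, Pi.mul_apply, e2, measure_empty, mul_zero]

theorem measurable_stdNoise (hs : IsStaticSampling P Y a σ X V ε)
    (hσc : ∀ x, ContinuousOn (σ x) (interior Y)) (i : ℕ) :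
    Measurable (stdNoise Y σ X V ε i) :=
  (hs.measurable_noise i).div ((measurable_scale hσc).comp
    ((hs.measurable_decision i).prodMk (hs.measurable_context i)))

/-- Given the pair, the noise is normal with standard deviation `σ`; dividing by `σ` leaves the same
standard normal law whatever the pair is, hence the factorization. -/
theorem measure_decision_context_stdNoise (hs : IsStaticSampling P Y a σ X V ε)
    (hσ : ∀ x, ∀ y ∈ interior Y, 0 < σ x y)
    (hσc : ∀ x, ContinuousOn (σ x) (interior Y)) (hac : ∀ x, ContinuousOn (a x) (interior Y))
    (i : ℕ) (x : χ) {B : Set (EuclideanSpace ℝ (Fin d))} {S : Set ℝ} (hB : MeasurableSet B)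
    (hS : MeasurableSet S) :
    P {ω | X i ω = x ∧ V i ω ∈ B ∧ stdNoise Y σ X V ε i ω ∈ S} =
      P {ω | X i ω = x ∧ V i ω ∈ B} * gaussianReal 0 1 S := by
  have hsm := measurable_scale_apply (Y := Y) hσc x
  have hmap : Measurable fun q : EuclideanSpace ℝ (Fin d) × ℝ =>
      (q.1, scale Y σ (x, q.1) * q.2) :=
    measurable_fst.prodMk ((hsm.comp measurable_fst).mul measurable_snd)
  have hVε : Measurable fun ω => (V i ω, ε i ω) :=
    (hs.measurable_context i).prodMk (hs.measurable_noise i)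
  set D : Set (EuclideanSpace ℝ (Fin d) × ℝ) := {q | q.1 ∈ B ∧ q.2 / scale Y σ (x, q.1) ∈ S}
  have hD : MeasurableSet D :=
    (measurable_fst hB).inter ((measurable_snd.div (hsm.comp measurable_fst)) hS)
  have e : {ω | X i ω = x ∧ V i ω ∈ B ∧ stdNoise Y σ X V ε i ω ∈ S} =
      (fun ω => (V i ω, ε i ω)) ⁻¹' D ∩ {ω | X i ω = x} := by
    ext ω
    simp only [D, stdNoise, Set.mem_ofPred_eq, Set.mem_inter_iff, Set.mem_preimage]
    constructor
    · rintro ⟨rfl, h⟩; exact ⟨h, rfl⟩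
    · rintro ⟨h, rfl⟩; exact ⟨rfl, h⟩
  have e2 : (fun q : EuclideanSpace ℝ (Fin d) × ℝ =>
      (q.1, scale Y σ (x, q.1) * q.2)) ⁻¹' D = B ×ˢ S := by
    ext q
    simp [D, mul_div_cancel_left₀ _ (scale_pos hσ (x, q.1)).ne']
  rw [e, ← Measure.restrict_apply (hVε hD), ← Measure.map_apply hVε hD,
    hs.map_context_noise hσc hac i x, Measure.map_apply hmap hD, e2, Measure.prod_prod,
    withDensity_apply _ hB, Measure.restrict_restrict hB, hs.measure_decision_context i x hB]

theorem measure_inter_stdNoise (hs : IsStaticSampling P Y a σ X V ε)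
    (hσ : ∀ x, ∀ y ∈ interior Y, 0 < σ x y)
    (hσc : ∀ x, ContinuousOn (σ x) (interior Y)) (hac : ∀ x, ContinuousOn (a x) (interior Y))
    (i : ℕ) {A : Set (χ × EuclideanSpace ℝ (Fin d))} {S : Set ℝ} (hA : MeasurableSet A)
    (hS : MeasurableSet S) :
    P ((fun ω => (X i ω, V i ω)) ⁻¹' A ∩ stdNoise Y σ X V ε i ⁻¹' S) =
      P ((fun ω => (X i ω, V i ω)) ⁻¹' A) * gaussianReal 0 1 S := by
  have hη := hs.measurable_stdNoise hσc i
  have hXm := fun x => hs.measurable_decision i (measurableSet_singleton x)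
  have hAx : ∀ x : χ, MeasurableSet (Prod.mk x ⁻¹' A) := fun x => measurable_prodMk_left hA
  have hVx := fun x => hs.measurable_context i (hAx x)
  have e1 : (fun ω => (X i ω, V i ω)) ⁻¹' A ∩ stdNoise Y σ X V ε i ⁻¹' S =
      ⋃ x, {ω | X i ω = x ∧ V i ω ∈ Prod.mk x ⁻¹' A ∧ stdNoise Y σ X V ε i ω ∈ S} := by
    ext ω; simp
  have e2 : (fun ω => (X i ω, V i ω)) ⁻¹' A =
      ⋃ x, {ω | X i ω = x ∧ V i ω ∈ Prod.mk x ⁻¹' A} := by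
    ext ω; simp
  rw [e1, e2, measure_iUnion, measure_iUnion, ← ENNReal.tsum_mul_right]
  · exact tsum_congr fun x => hs.measure_decision_context_stdNoise hσ hσc hac i x (hAx x) hS
  · intro x x' hxx
    refine Set.disjoint_left.2 fun ω h h' => hxx ?_
    exact h.1.symm.trans h'.1
  · exact fun x => (hXm x).inter (hVx x)
  · intro x x' hxx
    refine Set.disjoint_left.2 fun ω h h' => hxx ?_
    exact h.1.symm.trans h'.1
  · exact fun x => (hXm x).inter ((hVx x).inter (hη hS))

theorem map_stdNoise (hs : IsStaticSampling P Y a σ X V ε)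
    (hσ : ∀ x, ∀ y ∈ interior Y, 0 < σ x y)
    (hσc : ∀ x, ContinuousOn (σ x) (interior Y)) (hac : ∀ x, ContinuousOn (a x) (interior Y))
    (i : ℕ) : P.map (stdNoise Y σ X V ε i) = gaussianReal 0 1 := by
  ext S hS
  rw [Measure.map_apply (hs.measurable_stdNoise hσc i) hS]
  simpa using hs.measure_inter_stdNoise hσ hσc hac i MeasurableSet.univ hS

theorem iIndepFun_stdNoise (hs : IsStaticSampling P Y a σ X V ε)
    (hσc : ∀ x, ContinuousOn (σ x) (interior Y)) : iIndepFun (stdNoise Y σ X V ε) P := by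
  have hsc := measurable_scale (Y := Y) hσc
  refine hs.indep.comp (fun _ q => q.2.2 / scale Y σ (q.1, q.2.1)) fun _ => ?_
  exact (measurable_snd.comp measurable_snd).div
    (hsc.comp (measurable_fst.prodMk (measurable_fst.comp measurable_snd)))

theorem iIndepFun_decision_context (hs : IsStaticSampling P Y a σ X V ε) :
    iIndepFun (fun i ω => (X i ω, V i ω)) P :=
  hs.indep.comp (fun _ q => (q.1, q.2.1)) fun _ =>
    measurable_fst.prodMk (measurable_fst.comp measurable_snd)

/-- This neutralizes the random choice of runs: `Psi`, the activation time and the weights are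
functions of the pairs alone, so they act as constants for the standardized noise. -/
theorem indepFun_decision_context_stdNoise (hs : IsStaticSampling P Y a σ X V ε)
    (hσ : ∀ x, ∀ y ∈ interior Y, 0 < σ x y)
    (hσc : ∀ x, ContinuousOn (σ x) (interior Y)) (hac : ∀ x, ContinuousOn (a x) (interior Y)) :
    IndepFun (fun ω i => (X i ω, V i ω)) (fun ω i => stdNoise Y σ X V ε i ω) P := by
  have hsc := measurable_scale (Y := Y) hσc
  refine indepFun_pi_of_iIndepFun_prodMk
    (fun i => (hs.measurable_decision i).prodMk (hs.measurable_context i))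
    (hs.measurable_stdNoise hσc) ?_ fun i => ?_
  · refine hs.indep.comp (fun _ q => ((q.1, q.2.1), q.2.2 / scale Y σ (q.1, q.2.1))) fun _ => ?_
    have h1 : Measurable fun q : χ × EuclideanSpace ℝ (Fin d) × ℝ => (q.1, q.2.1) :=
      measurable_fst.prodMk (measurable_fst.comp measurable_snd)
    exact h1.prodMk ((measurable_snd.comp measurable_snd).div (hsc.comp h1))
  · rw [indepFun_iff_measure_inter_preimage_eq_mul]
    intro A S hA hS
    rw [hs.measure_inter_stdNoise hσ hσc hac i hA hS, ← hs.map_stdNoise hσ hσc hac i,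
      Measure.map_apply (hs.measurable_stdNoise hσc i) hS]

end IsStaticSampling

end Sampling

end SNE

namespace SNE

/-! ## Combinatorics of the neighborhood samples -/

section Neighborhood

set_option linter.unusedSectionVars false

variable {χ : Type*} {d : ℕ}

theorem radius_nonneg {c ξ : ℝ} (hc : 0 ≤ c) (m : ℕ) : 0 ≤ radius d c ξ m := by
  unfold radius; positivity

/-- Index `0` must be excluded: a nonzero real power of `0` is `0`, so the radius there is not the
largest one. -/
theorem radius_le_radius {c ξ : ℝ} (hc : 0 ≤ c) (hξ : 0 ≤ ξ) {m n : ℕ} (hm : 1 ≤ m)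
    (hmn : m ≤ n) : radius d c ξ n ≤ radius d c ξ m := by
  have h0 : (0 : ℝ) < m := by exact_mod_cast hm
  refine mul_le_mul_of_nonneg_left ?_ hc
  refine Real.rpow_le_rpow_of_nonpos h0 (by exact_mod_cast hmn) ?_
  rw [neg_div]
  exact neg_nonpos.2 (by positivity)

variable {Y : Set (EuclideanSpace ℝ (Fin d))} {c ξ : ℝ} {X : ℕ → χ}
  {V : ℕ → EuclideanSpace ℝ (Fin d)} {t : ℕ} {x : χ} {y : EuclideanSpace ℝ (Fin d)}

theorem mem_mSet {m i : ℕ} : i ∈ mSet Y c ξ X V t x y m ↔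
    i < t ∧ X i = x ∧ ‖V i - y‖ < radius d c ξ m ∧ V i ∈ interior Y := by
  simp [mSet, localSamples]

theorem mSet_mono {s : ℕ} (h : s ≤ t) (m : ℕ) :
    mSet Y c ξ X V s x y m ⊆ mSet Y c ξ X V t x y m := fun i hi => by
  rw [mem_mSet] at hi ⊢
  exact ⟨hi.1.trans_le h, hi.2⟩

theorem card_mSet_succ_le (m : ℕ) :
    (mSet Y c ξ X V (t + 1) x y m).card ≤ (mSet Y c ξ X V t x y m).card + 1 := by
  classical
  refine (Finset.card_le_card (t := insert t (mSet Y c ξ X V t x y m)) fun i hi => ?_).trans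
    (Finset.card_insert_le _ _)
  rw [Finset.mem_insert, mem_mSet]
  rw [mem_mSet] at hi
  rcases Nat.lt_succ_iff_lt_or_eq.1 hi.1 with h | h
  · exact Or.inr ⟨h, hi.2⟩
  · exact Or.inl h

/-- A discrete intermediate value argument: the cardinality starts at `0` and grows by at most one
per stage. -/
theorem exists_card_mSet_eq {m k : ℕ} (hk : k ≤ (mSet Y c ξ X V t x y m).card) :
    ∃ s ≤ t, (mSet Y c ξ X V s x y m).card = k := by
  induction t with
  | zero => exact ⟨0, le_rfl, le_antisymm (by simp [mSet, localSamples]) hk⟩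
  | succ t ih =>
    rcases Nat.lt_or_ge (mSet Y c ξ X V t x y m).card k with h | h
    · exact ⟨t + 1, le_rfl, le_antisymm ((card_mSet_succ_le m).trans h) hk⟩
    · obtain ⟨s, hs, e⟩ := ih h
      exact ⟨s, hs.trans (Nat.le_succ t), e⟩

theorem Psi_le_card : Psi Y c ξ X V t x y ≤ (mSet Y c ξ X V t x y (Psi Y c ξ X V t x y)).card :=
  Nat.findGreatest_spec (P := fun m => m ≤ (mSet Y c ξ X V t x y m).card) (Nat.zero_le t)
    (Nat.zero_le _)

theorem card_mSet_le (m : ℕ) : (mSet Y c ξ X V t x y m).card ≤ t := by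
  classical
  refine (Finset.card_le_card (t := Finset.range t) fun i hi => ?_).trans
    (Finset.card_range t).le
  exact Finset.mem_range.2 (mem_mSet.1 hi).1

/-- The search bound `t` in `Psi` loses nothing, since an `m`-set on stage `t` has at most `t`
elements. -/
theorem le_Psi {k : ℕ} (hk : k ≤ (mSet Y c ξ X V t x y k).card) : k ≤ Psi Y c ξ X V t x y :=
  Nat.le_findGreatest (hk.trans (card_mSet_le k)) hk

theorem activationTime_spec :
    activationTime Y c ξ X V t x y (Psi Y c ξ X V t x y) ≤ t ∧
      (neighborhood Y c ξ X V t x y).card = Psi Y c ξ X V t x y :=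
  Nat.sInf_mem (s := {t' | t' ≤ t ∧ (mSet Y c ξ X V t' x y (Psi Y c ξ X V t x y)).card =
    Psi Y c ξ X V t x y}) (exists_card_mSet_eq Psi_le_card)

theorem mem_mSet_of_mem_neighborhood {i : ℕ} (hi : i ∈ neighborhood Y c ξ X V t x y) :
    i ∈ mSet Y c ξ X V t x y (Psi Y c ξ X V t x y) :=
  mSet_mono activationTime_spec.1 _ hi

open Classical in
/-- The weight of the `i`-th observation in the shrinking neighborhood estimate. -/
noncomputable def weight (Y : Set (EuclideanSpace ℝ (Fin d))) (c ξ : ℝ) (X : ℕ → χ)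
    (V : ℕ → EuclideanSpace ℝ (Fin d)) (t : ℕ) (x : χ) (y : EuclideanSpace ℝ (Fin d)) (i : ℕ) :
    ℝ :=
  if i ∈ neighborhood Y c ξ X V t x y then ((Psi Y c ξ X V t x y : ℕ) : ℝ)⁻¹ else 0

theorem weight_nonneg (i : ℕ) : 0 ≤ weight Y c ξ X V t x y i := by
  unfold weight; split_ifs <;> positivity

theorem sum_weight_mul (g : ℕ → ℝ) :
    ∑ i ∈ Finset.range t, weight Y c ξ X V t x y i * g i =
      (∑ i ∈ neighborhood Y c ξ X V t x y, g i) / (Psi Y c ξ X V t x y : ℝ) := by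
  classical
  have hsub : neighborhood Y c ξ X V t x y ⊆ Finset.range t := fun i hi =>
    Finset.mem_range.2 (mem_mSet.1 (mem_mSet_of_mem_neighborhood hi)).1
  rw [Finset.sum_div, ← Finset.sum_subset hsub]
  · refine Finset.sum_congr rfl fun i hi => ?_
    rw [weight, if_pos hi]; ring
  · intro i _ hi
    rw [weight, if_neg hi, zero_mul]

theorem sum_weight (hΨ : 1 ≤ Psi Y c ξ X V t x y) :
    ∑ i ∈ Finset.range t, weight Y c ξ X V t x y i = 1 := by
  have := sum_weight_mul (Y := Y) (c := c) (ξ := ξ) (X := X) (V := V) (t := t) (x := x) (y := y)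
    fun _ => 1
  simp only [mul_one, Finset.sum_const, activationTime_spec.2, nsmul_eq_mul] at this
  rw [this, div_self]
  exact_mod_cast (Nat.one_le_iff_ne_zero.1 hΨ)

theorem estimate_eq_sum_weight (G : ℕ → ℝ) :
    estimate Y c ξ X V G t x y = ∑ i ∈ Finset.range t, weight Y c ξ X V t x y i * G i :=
  (sum_weight_mul G).symm

theorem dist_lt_radius_of_mem_neighborhood (hc : 0 ≤ c) (hξ : 0 ≤ ξ) {k : ℕ} (hk : 1 ≤ k)
    (hkΨ : k ≤ Psi Y c ξ X V t x y) {i : ℕ} (hi : i ∈ neighborhood Y c ξ X V t x y) :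
    X i = x ∧ V i ∈ interior Y ∧ dist (V i) y ≤ radius d c ξ k := by
  obtain ⟨-, h1, h2, h3⟩ := mem_mSet.1 (mem_mSet_of_mem_neighborhood hi)
  refine ⟨h1, h3, ?_⟩
  rw [dist_eq_norm]
  exact h2.le.trans (radius_le_radius hc hξ hk hkΨ)

theorem abs_sum_weight_mul_sub_le {k : ℕ} (hk : 1 ≤ k) (hkΨ : k ≤ Psi Y c ξ X V t x y)
    {g : ℕ → ℝ} {m b : ℝ} (hg : ∀ i ∈ neighborhood Y c ξ X V t x y, |g i - m| ≤ b) :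
    |∑ i ∈ Finset.range t, weight Y c ξ X V t x y i * g i - m| ≤ b := by
  have h1 := sum_weight (hk.trans hkΨ)
  have e : ∑ i ∈ Finset.range t, weight Y c ξ X V t x y i * g i - m =
      ∑ i ∈ Finset.range t, weight Y c ξ X V t x y i * (g i - m) := by
    simp only [mul_sub, Finset.sum_sub_distrib, ← Finset.sum_mul, h1, one_mul]
  rw [e]
  refine (Finset.abs_sum_le_sum_abs _ _).trans ?_
  calc _ ≤ ∑ i ∈ Finset.range t, weight Y c ξ X V t x y i * b := by
        refine Finset.sum_le_sum fun i _ => ?_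
        rw [abs_mul, abs_of_nonneg (weight_nonneg i)]
        by_cases hi : i ∈ neighborhood Y c ξ X V t x y
        · exact mul_le_mul_of_nonneg_left (hg i hi) (weight_nonneg i)
        · simp [weight, hi]
    _ = b := by rw [← Finset.sum_mul, h1, one_mul]

/-- In each squared weight one factor is at most `1 / Psi ≤ 1 / k`; the remaining factors sum to
one. -/
theorem sum_sq_mul_weight_le {k : ℕ} (hk : 1 ≤ k) (hkΨ : k ≤ Psi Y c ξ X V t x y)
    {g : ℕ → ℝ} {b : ℝ} (hg : ∀ i ∈ neighborhood Y c ξ X V t x y, |g i| ≤ b) :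
    ∑ i ∈ Finset.range t, (g i * weight Y c ξ X V t x y i) ^ 2 ≤ b ^ 2 / k := by
  have h1 := sum_weight (hk.trans hkΨ)
  have hk0 : (0 : ℝ) < k := by exact_mod_cast hk
  have hle : (k : ℝ) ≤ Psi Y c ξ X V t x y := by exact_mod_cast hkΨ
  calc _ ≤ ∑ i ∈ Finset.range t, weight Y c ξ X V t x y i * (b ^ 2 / k) := by
        refine Finset.sum_le_sum fun i _ => ?_
        by_cases hi : i ∈ neighborhood Y c ξ X V t x y
        · have hw : weight Y c ξ X V t x y i ≤ (k : ℝ)⁻¹ := by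
            rw [weight, if_pos hi]; exact inv_anti₀ hk0 hle
          have hg2 : g i ^ 2 ≤ b ^ 2 := by
            rw [← sq_abs (g i)]; exact pow_le_pow_left₀ (abs_nonneg _) (hg i hi) 2
          have h0 := weight_nonneg (Y := Y) (c := c) (ξ := ξ) (X := X) (V := V) (t := t) (x := x)
            (y := y) i
          rw [mul_pow, sq (weight _ _ _ _ _ _ _ _ _), div_eq_mul_inv]
          calc _ = weight Y c ξ X V t x y i * (g i ^ 2 * weight Y c ξ X V t x y i) := by ring
            _ ≤ _ := by gcongr
        · simp [weight, hi]
    _ = b ^ 2 / k := by rw [← Finset.sum_mul, h1, one_mul]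

/-- A run uses only one decision, so the neighborhoods of different decisions are disjoint. This
removes the cross terms from the variance of a difference of estimates. -/
theorem weight_mul_weight_eq_zero {x' : χ} (hx : x ≠ x') (i : ℕ) :
    weight Y c ξ X V t x y i * weight Y c ξ X V t x' y i = 0 := by
  by_cases hi : i ∈ neighborhood Y c ξ X V t x y
  · by_cases hi' : i ∈ neighborhood Y c ξ X V t x' y
    · have h1 := (mem_mSet.1 (mem_mSet_of_mem_neighborhood hi)).2.1
      have h2 := (mem_mSet.1 (mem_mSet_of_mem_neighborhood hi')).2.1
      exact absurd (h1.symm.trans h2) hx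
    · simp [weight, hi']
  · simp [weight, hi]

/-! ### Measurability in the data set -/

variable [Finite χ] [MeasurableSpace χ] [MeasurableSingletonClass χ]

theorem measurableSet_mem_mSet (Y : Set (EuclideanSpace ℝ (Fin d))) (c ξ : ℝ) (t : ℕ) (x : χ)
    (y : EuclideanSpace ℝ (Fin d)) (m i : ℕ) :
    MeasurableSet {z : ℕ → χ × EuclideanSpace ℝ (Fin d) |
      i ∈ mSet Y c ξ (fun i => (z i).1) (fun i => (z i).2) t x y m} := by
  simp only [mem_mSet]
  have hX : Measurable fun z : ℕ → χ × EuclideanSpace ℝ (Fin d) => (z i).1 :=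
    measurable_fst.comp (measurable_pi_apply i)
  have hV : Measurable fun z : ℕ → χ × EuclideanSpace ℝ (Fin d) => (z i).2 :=
    measurable_snd.comp (measurable_pi_apply i)
  refine (MeasurableSet.const _).inter ((hX (measurableSet_singleton x)).inter
    (MeasurableSet.inter ?_ (hV isOpen_interior.measurableSet)))
  have hn : Measurable fun z : ℕ → χ × EuclideanSpace ℝ (Fin d) => ‖(z i).2 - y‖ :=
    (hV.sub_const y).norm
  exact measurableSet_lt hn measurable_const

theorem measurable_card_mSet (Y : Set (EuclideanSpace ℝ (Fin d))) (c ξ : ℝ) (t : ℕ) (x : χ)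
    (y : EuclideanSpace ℝ (Fin d)) (m : ℕ) :
    Measurable fun z : ℕ → χ × EuclideanSpace ℝ (Fin d) =>
      (mSet Y c ξ (fun i => (z i).1) (fun i => (z i).2) t x y m).card := by
  classical
  have e : ∀ z : ℕ → χ × EuclideanSpace ℝ (Fin d),
      (mSet Y c ξ (fun i => (z i).1) (fun i => (z i).2) t x y m).card =
      ∑ i ∈ Finset.range t,
        if i ∈ mSet Y c ξ (fun i => (z i).1) (fun i => (z i).2) t x y m then 1 else 0 := by
    intro z
    rw [← Finset.card_filter]
    congr 1
    ext i
    simp only [Finset.mem_filter, Finset.mem_range]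
    exact ⟨fun h => ⟨(mem_mSet.1 h).1, h⟩, fun h => h.2⟩
  simp only [e]
  exact Finset.measurable_sum _ fun i _ =>
    Measurable.ite (measurableSet_mem_mSet Y c ξ t x y m i) measurable_const measurable_const

theorem measurable_Psi (Y : Set (EuclideanSpace ℝ (Fin d))) (c ξ : ℝ) (t : ℕ) (x : χ)
    (y : EuclideanSpace ℝ (Fin d)) :
    Measurable fun z : ℕ → χ × EuclideanSpace ℝ (Fin d) =>
      Psi Y c ξ (fun i => (z i).1) (fun i => (z i).2) t x y :=
  measurable_findGreatest fun k _ =>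
    measurableSet_le measurable_const (measurable_card_mSet Y c ξ t x y k)

theorem measurable_activationTime (Y : Set (EuclideanSpace ℝ (Fin d))) (c ξ : ℝ) (t : ℕ) (x : χ)
    (y : EuclideanSpace ℝ (Fin d)) (m : ℕ) :
    Measurable fun z : ℕ → χ × EuclideanSpace ℝ (Fin d) =>
      activationTime Y c ξ (fun i => (z i).1) (fun i => (z i).2) t x y m := by
  obtain ⟨S, hSdef⟩ : ∃ S : (ℕ → χ × EuclideanSpace ℝ (Fin d)) → Set ℕ, S = fun z =>
      {t' : ℕ | t' ≤ t ∧
        (mSet Y c ξ (fun i => (z i).1) (fun i => (z i).2) t' x y m).card = m} := ⟨_, rfl⟩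
  have hS : ∀ n, MeasurableSet {z | n ∈ S z} := fun n => by
    subst hSdef
    exact (MeasurableSet.const _).inter
      (measurable_card_mSet Y c ξ n x y m (measurableSet_singleton m))
  have hact : (fun z : ℕ → χ × EuclideanSpace ℝ (Fin d) =>
      activationTime Y c ξ (fun i => (z i).1) (fun i => (z i).2) t x y m) =
      fun z => sInf (S z) := by
    subst hSdef; rfl
  rw [hact]
  refine measurable_to_countable' fun n => ?_
  -- Either `n` is the first element of `S z`, or `S z` is empty and the default `sInf ∅ = 0`
  -- applies.
  have e : (fun z => sInf (S z)) ⁻¹' {n} =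
      ({z | n ∈ S z} ∩ {z | ∀ k, k < n → k ∉ S z}) ∪ ({_z | n = 0} ∩ {z | ∀ k, k ∉ S z}) := by
    ext z
    simp only [Set.mem_preimage, Set.mem_singleton_iff, Set.mem_union, Set.mem_inter_iff,
      Set.mem_ofPred_eq]
    constructor
    · rintro rfl
      by_cases h : (S z).Nonempty
      · exact Or.inl ⟨Nat.sInf_mem h, fun k hk => Nat.notMem_of_lt_sInf hk⟩
      · rw [Set.not_nonempty_iff_eq_empty] at h
        simp [h]
    · rintro (⟨h1, h2⟩ | ⟨rfl, h⟩)
      · exact le_antisymm (Nat.sInf_le h1) (not_lt.1 fun hlt => h2 _ hlt (Nat.sInf_mem ⟨n, h1⟩))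
      · rw [Set.eq_empty_of_forall_notMem h, Nat.sInf_empty]
  rw [e]
  refine MeasurableSet.union ((hS n).inter ?_) ((MeasurableSet.const _).inter ?_)
  · simp only [Set.ofPred_forall]
    exact MeasurableSet.iInter fun k => MeasurableSet.iInter fun _ => (hS k).compl
  · simp only [Set.ofPred_forall]
    exact MeasurableSet.iInter fun k => (hS k).compl

theorem measurable_weight (Y : Set (EuclideanSpace ℝ (Fin d))) (c ξ : ℝ) (t : ℕ) (x : χ)
    (y : EuclideanSpace ℝ (Fin d)) (i : ℕ) :
    Measurable fun z : ℕ → χ × EuclideanSpace ℝ (Fin d) =>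
      weight Y c ξ (fun i => (z i).1) (fun i => (z i).2) t x y i := by
  have hΨ := measurable_Psi (χ := χ) Y c ξ t x y
  refine Measurable.ite ?_ ((measurable_from_nat (f := fun n : ℕ => ((n : ℝ))⁻¹)).comp hΨ)
    measurable_const
  -- Splitting by the countably many values of `Psi` and of the activation time reduces to `m`-sets
  -- with deterministic index and stage.
  have e : {z : ℕ → χ × EuclideanSpace ℝ (Fin d) |
      i ∈ neighborhood Y c ξ (fun i => (z i).1) (fun i => (z i).2) t x y} =
      ⋃ m : ℕ, ⋃ n : ℕ,
        ({z | Psi Y c ξ (fun i => (z i).1) (fun i => (z i).2) t x y = m} ∩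
          {z | activationTime Y c ξ (fun i => (z i).1) (fun i => (z i).2) t x y m = n}) ∩
          {z | i ∈ mSet Y c ξ (fun i => (z i).1) (fun i => (z i).2) n x y m} := by
    ext z
    simp only [Set.mem_iUnion, Set.mem_inter_iff, Set.mem_ofPred_eq]
    constructor
    · intro h
      exact ⟨_, _, ⟨rfl, rfl⟩, h⟩
    · rintro ⟨m, n, ⟨rfl, rfl⟩, h⟩
      exact h
  rw [e]
  exact MeasurableSet.iUnion fun m => MeasurableSet.iUnion fun n =>
    ((hΨ (measurableSet_singleton m)).inter
      (measurable_activationTime Y c ξ t x y m (measurableSet_singleton n))).inter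
      (measurableSet_mem_mSet Y c ξ n x y m i)

end Neighborhood

end SNE

namespace SNE

/-! ## Probability bounds at a fixed stage -/

section Bounds

set_option linter.unusedSectionVars false

variable {χ : Type*} {d : ℕ} {Y : Set (EuclideanSpace ℝ (Fin d))} {c ξ : ℝ}

/-- The exponent `-ξ / d` of the radius is made so that the dimension cancels. Balancing `t k ^
(-ξ)` against `k` then yields the scale `t ^ (1 / (1 + ξ))`. -/
theorem volume_ball_radius (hd : 0 < d) (hc : 0 ≤ c) {k : ℕ} (y : EuclideanSpace ℝ (Fin d)) :
    volume (Metric.ball y (radius d c ξ k)) =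
      ENNReal.ofReal (volConst d c * (k : ℝ) ^ (-ξ)) := by
  have : Nonempty (Fin d) := ⟨⟨0, hd⟩⟩
  have hd0 : (d : ℝ) ≠ 0 := by exact_mod_cast hd.ne'
  have hr := radius_nonneg (d := d) (ξ := ξ) hc k
  rw [EuclideanSpace.volume_ball, Fintype.card_fin, ← ENNReal.ofReal_pow hr,
    ← ENNReal.ofReal_mul (by positivity)]
  congr 1
  have e1 : √Real.pi ^ d = Real.pi ^ ((d : ℝ) / 2) := by
    rw [Real.sqrt_eq_rpow, ← Real.rpow_mul_natCast Real.pi_pos.le]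
    ring_nf
  have e2 : ((k : ℝ) ^ (-ξ / (d : ℝ))) ^ d = (k : ℝ) ^ (-ξ) := by
    rw [← Real.rpow_mul_natCast (Nat.cast_nonneg k), div_mul_cancel₀ _ hd0]
  rw [radius, mul_pow, e1, e2, volConst]
  ring

theorem volConst_pos (d : ℕ) (hc : 0 < c) : 0 < volConst d c := by
  unfold volConst
  have : 0 < Real.Gamma ((d : ℝ) / 2 + 1) := Real.Gamma_pos_of_pos (by positivity)
  have := Real.pi_pos
  positivity

variable [Finite χ] [MeasurableSpace χ] [MeasurableSingletonClass χ]
  {f σ a : χ → EuclideanSpace ℝ (Fin d) → ℝ}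
  {Ω : Type*} [MeasurableSpace Ω] {P : Measure Ω} [IsProbabilityMeasure P]
  {X : ℕ → Ω → χ} {V : ℕ → Ω → EuclideanSpace ℝ (Fin d)} {ε : ℕ → Ω → ℝ}

/-- Chernoff bound for the event that the `k`-set of `(x, y)` is not activated on stage `t`. -/
theorem measure_Psi_lt_le (hs : IsStaticSampling P Y a σ X V ε) (hd : 0 < d) (hc : 0 ≤ c)
    {x : χ} {y : EuclideanSpace ℝ (Fin d)} {k : ℕ} {b : ℝ} (hb : 0 ≤ b)
    (hball : ∀ v ∈ Metric.ball y (radius d c ξ k), v ∈ interior Y ∧ b ≤ a x v)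
    {θ : ℝ} (hθ : 0 ≤ θ) (t : ℕ) :
    P {ω | Psi Y c ξ (fun i => X i ω) (fun i => V i ω) t x y < k} ≤
      ENNReal.ofReal (Real.exp (-(t * (b * (volConst d c * (k : ℝ) ^ (-ξ))) *
        (1 - Real.exp (-θ)) - k * θ))) := by
  classical
  set S : Set (χ × EuclideanSpace ℝ (Fin d)) :=
    {q | q.1 = x ∧ q.2 ∈ Metric.ball y (radius d c ξ k)} with hSdef
  have hS : MeasurableSet S :=
    (measurable_fst (measurableSet_singleton x)).inter
      (measurable_snd Metric.isOpen_ball.measurableSet)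
  have hZ : ∀ i, Measurable fun ω => (X i ω, V i ω) := fun i =>
    (hs.measurable_decision i).prodMk (hs.measurable_context i)
  have hp : ∀ i, b * (volConst d c * (k : ℝ) ^ (-ξ)) ≤
      P.real ((fun ω => (X i ω, V i ω)) ⁻¹' S) := by
    intro i
    have e : (fun ω => (X i ω, V i ω)) ⁻¹' S =
        {ω | X i ω = x ∧ V i ω ∈ Metric.ball y (radius d c ξ k)} := rfl
    have hsub : Metric.ball y (radius d c ξ k) ∩ interior Y = Metric.ball y (radius d c ξ k) :=
      Set.inter_eq_left.2 fun v hv => (hball v hv).1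
    rw [Measure.real, ← ENNReal.ofReal_le_iff_le_toReal (measure_ne_top _ _), e,
      hs.measure_decision_context i x Metric.isOpen_ball.measurableSet, hsub,
      ENNReal.ofReal_mul hb, ← volume_ball_radius hd hc y, ← setLIntegral_const]
    exact setLIntegral_mono' Metric.isOpen_ball.measurableSet fun v hv =>
      ENNReal.ofReal_le_ofReal (hball v hv).2
  refine (measure_mono ?_).trans
    (measure_card_filter_le hZ hs.iIndepFun_decision_context hS hp hθ t k)
  intro ω hω
  -- If the `k`-set had `k` elements, `k` would be a candidate for `Psi`; so there are fewer than
  -- `k` hits.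
  have h1 : (mSet Y c ξ (fun i => X i ω) (fun i => V i ω) t x y k).card < k := by
    by_contra h
    exact absurd (le_Psi (not_lt.1 h)) (not_le.2 hω)
  have h2 : ((Finset.range t).filter fun i => (X i ω, V i ω) ∈ S) ⊆
      mSet Y c ξ (fun i => X i ω) (fun i => V i ω) t x y k := by
    intro i hi
    rw [Finset.mem_filter, Finset.mem_range] at hi
    obtain ⟨h1, h2, h3⟩ := hi
    exact mem_mSet.2 ⟨h1, h2, by simpa [dist_eq_norm] using h3, (hball _ h3).1⟩
  have h3 := (Finset.card_le_card h2).trans h1.le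
  have h4 : (((Finset.range t).filter fun i => (X i ω, V i ω) ∈ S).card : ℝ) ≤ k := by
    exact_mod_cast h3
  change (_ : ℝ) ≤ k
  convert h4

/-- Gaussian tail bound for the event that `x` looks at least as good as `xs`, when both
estimates rely on sufficiently many observations. -/
theorem measure_estimate_le_le (hs : IsStaticSampling P Y a σ X V ε) (hc : 0 ≤ c) (hξ : 0 ≤ ξ)
    {L₁ L₂ : ℝ≥0} (hf_lip : ∀ x, LipschitzOnWith L₁ (f x) Y)
    (hσ_pos : ∀ x, ∀ y ∈ Y, 0 < σ x y) (hσ_lip : ∀ x, LipschitzOnWith L₂ (σ x) Y)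
    (ha_cont : ∀ x, ContinuousOn (a x) (interior Y)) {y : EuclideanSpace ℝ (Fin d)} (hy : y ∈ Y)
    {x xs : χ} (hx : x ≠ xs) {k k' : ℕ} (hk : 1 ≤ k) (hk' : 1 ≤ k') (t : ℕ)
    (hΔ : 0 ≤ f x y - f xs y - L₁ * (radius d c ξ k + radius d c ξ k')) :
    P {ω | k ≤ Psi Y c ξ (fun i => X i ω) (fun i => V i ω) t x y ∧
        k' ≤ Psi Y c ξ (fun i => X i ω) (fun i => V i ω) t xs y ∧
        estimate Y c ξ (fun i => X i ω) (fun i => V i ω)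
            (fun i => f (X i ω) (V i ω) + ε i ω) t x y ≤
          estimate Y c ξ (fun i => X i ω) (fun i => V i ω)
            (fun i => f (X i ω) (V i ω) + ε i ω) t xs y} ≤
      ENNReal.ofReal (Real.exp (-(f x y - f xs y -
        L₁ * (radius d c ξ k + radius d c ξ k')) ^ 2 /
        (2 * ((σ x y + L₂ * radius d c ξ k) ^ 2 / k +
          (σ xs y + L₂ * radius d c ξ k') ^ 2 / k')))) := by
  have hint : interior Y ⊆ Y := interior_subset
  have hσi : ∀ x, ∀ y ∈ interior Y, 0 < σ x y := fun x y h => hσ_pos x y (hint h)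
  have hσc : ∀ x, ContinuousOn (σ x) (interior Y) := fun x => (hσ_lip x).continuousOn.mono hint
  have hbias : ∀ {X : ℕ → χ} {V : ℕ → EuclideanSpace ℝ (Fin d)} {x : χ} {k : ℕ}, 1 ≤ k →
      k ≤ Psi Y c ξ X V t x y → ∀ i ∈ neighborhood Y c ξ X V t x y,
      |f (X i) (V i) - f x y| ≤ L₁ * radius d c ξ k := by
    intro X V x k hk hkΨ i hi
    obtain ⟨h1, h2, h3⟩ := dist_lt_radius_of_mem_neighborhood hc hξ hk hkΨ hi
    rw [h1, ← Real.dist_eq]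
    exact ((hf_lip x).dist_le_mul _ (hint h2) _ hy).trans
      (mul_le_mul_of_nonneg_left h3 L₁.2)
  have hscale : ∀ {X : ℕ → χ} {V : ℕ → EuclideanSpace ℝ (Fin d)} {x : χ} {k : ℕ}, 1 ≤ k →
      k ≤ Psi Y c ξ X V t x y → ∀ i ∈ neighborhood Y c ξ X V t x y,
      |scale Y σ (X i, V i)| ≤ σ x y + L₂ * radius d c ξ k := by
    intro X V x k hk hkΨ i hi
    obtain ⟨h1, h2, h3⟩ := dist_lt_radius_of_mem_neighborhood hc hξ hk hkΨ hi
    rw [abs_of_pos (scale_pos hσi _), h1, scale_of_mem h2]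
    have := ((hσ_lip x).dist_le_mul _ (hint h2) _ hy).trans
      (mul_le_mul_of_nonneg_left h3 L₂.2)
    rw [Real.dist_eq] at this
    linarith [le_abs_self (σ x (V i) - σ x y)]
  -- The coefficient of the `i`-th standardized noise in the difference of the two estimates, as a
  -- function of decisions and contexts.
  set w : ℕ → (ℕ → χ × EuclideanSpace ℝ (Fin d)) → ℝ := fun i z =>
    scale Y σ (z i) * weight Y c ξ (fun i => (z i).1) (fun i => (z i).2) t x y i -
      scale Y σ (z i) * weight Y c ξ (fun i => (z i).1) (fun i => (z i).2) t xs y i with hw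
  have hwm : ∀ i, Measurable (w i) := fun i => by
    have h1 : Measurable fun z : ℕ → χ × EuclideanSpace ℝ (Fin d) => scale Y σ (z i) :=
      (measurable_scale hσc).comp (measurable_pi_apply i)
    exact (h1.mul (measurable_weight Y c ξ t x y i)).sub
      (h1.mul (measurable_weight Y c ξ t xs y i))
  set A : Set (ℕ → χ × EuclideanSpace ℝ (Fin d)) :=
    {z | k ≤ Psi Y c ξ (fun i => (z i).1) (fun i => (z i).2) t x y} ∩
      {z | k' ≤ Psi Y c ξ (fun i => (z i).1) (fun i => (z i).2) t xs y} with hAdef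
  have hA : MeasurableSet A :=
    (measurableSet_le measurable_const (measurable_Psi Y c ξ t x y)).inter
      (measurableSet_le measurable_const (measurable_Psi Y c ξ t xs y))
  have hvar : ∀ z ∈ A, ∑ i ∈ Finset.range t, w i z ^ 2 ≤
      (σ x y + L₂ * radius d c ξ k) ^ 2 / k + (σ xs y + L₂ * radius d c ξ k') ^ 2 / k' := by
    rintro z ⟨hz, hz'⟩
    refine le_trans (le_of_eq ?_) (add_le_add
      (sum_sq_mul_weight_le hk hz (g := fun i => scale Y σ (z i)) (hscale hk hz))
      (sum_sq_mul_weight_le hk' hz' (g := fun i => scale Y σ (z i)) (hscale hk' hz')))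
    rw [← Finset.sum_add_distrib]
    refine Finset.sum_congr rfl fun i _ => ?_
    have h0 := weight_mul_weight_eq_zero (Y := Y) (c := c) (ξ := ξ) (X := fun i => (z i).1)
      (V := fun i => (z i).2) (t := t) (y := y) hx i
    simp only [hw]
    linear_combination (-2 * scale Y σ (z i) ^ 2) * h0
  refine (measure_mono ?_).trans (measure_sum_le_neg_of_indepFun
    (measurable_pi_iff.2 fun i => (hs.measurable_decision i).prodMk (hs.measurable_context i))
    (hs.measurable_stdNoise hσc)
    (hs.indepFun_decision_context_stdNoise hσi hσc ha_cont) (hs.iIndepFun_stdNoise hσc)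
    (hs.map_stdNoise hσi hσc ha_cont) (Finset.range t) hwm hA hΔ hvar)
  rintro ω ⟨h1, h2, h3⟩
  refine ⟨⟨h1, h2⟩, ?_⟩
  have e : ∀ x, ∑ i ∈ Finset.range t,
      weight Y c ξ (fun i => X i ω) (fun i => V i ω) t x y i * (f (X i ω) (V i ω) + ε i ω) =
      ∑ i ∈ Finset.range t,
        weight Y c ξ (fun i => X i ω) (fun i => V i ω) t x y i * f (X i ω) (V i ω) +
      ∑ i ∈ Finset.range t, scale Y σ (X i ω, V i ω) *
        weight Y c ξ (fun i => X i ω) (fun i => V i ω) t x y i * stdNoise Y σ X V ε i ω := by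
    intro x
    rw [← Finset.sum_add_distrib]
    refine Finset.sum_congr rfl fun i _ => ?_
    have := (scale_pos hσi (X i ω, V i ω)).ne'
    rw [stdNoise]
    field_simp
  rw [estimate_eq_sum_weight, estimate_eq_sum_weight, e, e] at h3
  -- The noise-free parts of the estimates differ by at least the gap minus both biases, so a wrong
  -- comparison pushes the noise difference below `-Δ`.
  have b1 := abs_le.1 (abs_sum_weight_mul_sub_le hk h1
    (g := fun i => f (X i ω) (V i ω)) (hbias hk h1))
  have b2 := abs_le.1 (abs_sum_weight_mul_sub_le hk' h2
    (g := fun i => f (X i ω) (V i ω)) (hbias hk' h2))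
  simp only [hw, sub_mul, Finset.sum_sub_distrib]
  linarith [b1.1, b2.2]

end Bounds

end SNE

namespace SNE

/-! ## The Lambert function -/

/-- From `log (v / u) < v / u - 1 = (v - u) / u ≤ v - u` for `1 ≤ u < v`. It makes the Lambert value
unique. -/
theorem sub_log_strictMonoOn : StrictMonoOn (fun u : ℝ => u - 1 - Real.log u) (Set.Ici 1) := by
  intro u hu v hv huv
  have hu1 : (1 : ℝ) ≤ u := hu
  have hu0 : 0 < u := by linarith
  have hv0 : 0 < v := by linarith
  have h1 := Real.log_lt_sub_one_of_pos (div_pos hv0 hu0) (by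
    rw [Ne, div_eq_one_iff_eq hu0.ne']; exact huv.ne')
  rw [Real.log_div hv0.ne' hu0.ne'] at h1
  have h2 : v / u - 1 ≤ v - u := by
    rw [div_sub_one hu0.ne']
    exact div_le_self (by linarith) hu1
  change u - 1 - Real.log u < v - 1 - Real.log v
  linarith

theorem exists_sub_log_eq {z : ℝ} (hz : 0 ≤ z) : ∃ u : ℝ, 1 ≤ u ∧ u - 1 - Real.log u = z := by
  have hc : ContinuousOn (fun u : ℝ => u - 1 - Real.log u) (Set.Icc 1 (2 * z + 2)) := by
    refine ContinuousOn.sub (by fun_prop) (Real.continuousOn_log.mono fun u hu => ?_)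
    have := hu.1
    simp only [Set.mem_compl_iff, Set.mem_singleton_iff]
    linarith
  -- The right endpoint is large enough because `log (2 * z + 2) = log 2 + log (z + 1) ≤ 1 + z`.
  have h2 : z ≤ 2 * z + 2 - 1 - Real.log (2 * z + 2) := by
    have h3 := Real.log_le_sub_one_of_pos (show 0 < z + 1 by linarith)
    have h4 := Real.log_le_sub_one_of_pos (show (0 : ℝ) < 2 by norm_num)
    have h5 : Real.log (2 * z + 2) = Real.log 2 + Real.log (z + 1) := by
      rw [← Real.log_mul (by norm_num) (by linarith)]; ring_nf
    linarith
  obtain ⟨u, hu, e⟩ := intermediate_value_Icc (by linarith) hc (⟨by simpa using hz, h2⟩ :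
    z ∈ Set.Icc ((1 : ℝ) - 1 - Real.log 1) (2 * z + 2 - 1 - Real.log (2 * z + 2)))
  exact ⟨u, hu.1, e⟩

/-- With `w = -u`, the logarithm of `u * exp (-u) = exp (-z - 1)` reads `u - 1 - log u = z`. This
has exactly one solution `u ≥ 1`, so the set behind the `sInf` is a singleton. -/
theorem neg_lambertWNegOne_spec {z : ℝ} (hz : 0 ≤ z) :
    1 ≤ -lambertWNegOne (-Real.exp (-z - 1)) ∧
      -lambertWNegOne (-Real.exp (-z - 1)) - 1 -
        Real.log (-lambertWNegOne (-Real.exp (-z - 1))) = z := by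
  obtain ⟨u, hu, e⟩ := exists_sub_log_eq hz
  have hS : {w : ℝ | w ≤ -1 ∧ w * Real.exp w = -Real.exp (-z - 1)} = {-u} := by
    ext w
    simp only [Set.mem_ofPred_eq, Set.mem_singleton_iff]
    constructor
    · rintro ⟨h1, h2⟩
      have hw0 : 0 < -w := by linarith
      have h3 : Real.log (-w * Real.exp w) = -z - 1 := by
        rw [neg_mul, h2, neg_neg, Real.log_exp]
      rw [Real.log_mul hw0.ne' (Real.exp_pos _).ne', Real.log_exp] at h3
      have := sub_log_strictMonoOn.injOn (show -w ∈ Set.Ici (1 : ℝ) by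
        simp only [Set.mem_Ici]; linarith) (show u ∈ Set.Ici (1 : ℝ) from hu)
        (by linarith)
      linarith
    · rintro rfl
      refine ⟨by linarith, ?_⟩
      have : Real.exp (-z - 1) = u * Real.exp (-u) := by
        rw [show -z - 1 = Real.log u + -u by linarith, Real.exp_add, Real.exp_log (by linarith)]
      rw [this]; ring
  rw [lambertWNegOne, hS, csInf_singleton, neg_neg]
  exact ⟨hu, e⟩

/-! ## Asymptotics of the exponents -/

theorem tendsto_stage_rpow_atTop {ξ : ℝ} (hξ : 0 < ξ) :
    Tendsto (fun t : ℕ => (t : ℝ) ^ (1 / (1 + ξ))) atTop atTop :=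
  (tendsto_rpow_atTop (by positivity)).comp tendsto_natCast_atTop_atTop

theorem tendsto_floor_div {τ : ℕ → ℝ} (hτ : Tendsto τ atTop atTop) {s : ℝ} (hs : 0 ≤ s) :
    Tendsto (fun t => (⌊s * τ t⌋₊ : ℝ) / τ t) atTop (𝓝 s) :=
  (tendsto_nat_floor_mul_div_atTop hs).comp hτ

theorem tendsto_floor_atTop {τ : ℕ → ℝ} (hτ : Tendsto τ atTop atTop) {s : ℝ} (hs : 0 < s) :
    Tendsto (fun t => ⌊s * τ t⌋₊) atTop atTop :=
  tendsto_nat_floor_atTop.comp (hτ.const_mul_atTop hs)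

theorem tendsto_radius {d : ℕ} (hd : 0 < d) (c : ℝ) {ξ : ℝ} (hξ : 0 < ξ) :
    Tendsto (fun k : ℕ => radius d c ξ k) atTop (𝓝 0) := by
  have h : Tendsto (fun k : ℕ => (k : ℝ) ^ (-(ξ / d))) atTop (𝓝 0) :=
    (tendsto_rpow_neg_atTop (by positivity)).comp tendsto_natCast_atTop_atTop
  simpa [radius, neg_div] using h.const_mul c

theorem eventually_exp_neg_le {τ E : ℕ → ℝ} (hτ : Tendsto τ atTop atTop) {l h : ℝ}
    (hE : Tendsto (fun t => E t / τ t) atTop (𝓝 l)) (hl : h < l) :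
    ∀ᶠ t in atTop, Real.exp (-E t) ≤ Real.exp (-(h * τ t)) := by
  filter_upwards [hE.eventually (lt_mem_nhds hl), hτ.eventually_gt_atTop 0] with t h1 h2
  rw [lt_div_iff₀ h2] at h1
  exact Real.exp_le_exp.2 (by linarith)

/-- Exponent of the activation probability of the `⌊s * t ^ (1 / (1 + ξ))⌋`-set. -/
theorem tendsto_activation_exponent {ξ : ℝ} (hξ : 0 < ξ) {s : ℝ} (hs : 0 < s) (b C q θ : ℝ) :
    Tendsto (fun t : ℕ => ((t : ℝ) * (b * (C * (⌊s * (t : ℝ) ^ (1 / (1 + ξ))⌋₊ : ℝ) ^ (-ξ))) * q -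
        (⌊s * (t : ℝ) ^ (1 / (1 + ξ))⌋₊ : ℝ) * θ) / (t : ℝ) ^ (1 / (1 + ξ))) atTop
      (𝓝 (b * (C * s ^ (-ξ)) * q - s * θ)) := by
  have hτ := tendsto_stage_rpow_atTop hξ
  have hk := tendsto_floor_div hτ hs.le
  have h1 := hk.rpow_const (p := -ξ) (Or.inl hs.ne')
  refine Tendsto.congr' ?_ ((((h1.const_mul C).const_mul b).mul_const q).sub (hk.mul_const θ))
  filter_upwards [hτ.eventually_gt_atTop 0, eventually_gt_atTop 0] with t ht ht0
  have ht0' : (0 : ℝ) < t := by exact_mod_cast ht0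
  -- With `τ = t ^ (1 / (1 + ξ))` one has `t = τ * τ ^ ξ`, so `t * k ^ (-ξ) / τ` equals `(k / τ) ^
  -- (-ξ)`.
  have e : (t : ℝ) = ((t : ℝ) ^ (1 / (1 + ξ))) * ((t : ℝ) ^ (1 / (1 + ξ))) ^ ξ := by
    rw [← Real.rpow_mul ht0'.le, ← Real.rpow_add ht0', ← mul_one_add, one_div_mul_cancel
      (by positivity), Real.rpow_one]
  generalize hT : (t : ℝ) ^ (1 / (1 + ξ)) = T at *
  rw [e, Real.div_rpow (Nat.cast_nonneg _) ht.le, Real.rpow_neg ht.le]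
  have : T ^ ξ ≠ 0 := (Real.rpow_pos_of_pos ht ξ).ne'
  field_simp

/-- The radii vanish, and with them the bias and the variation of `σ`; only the ratios of the
cutoffs to `τ`, with limits `s` and `s'`, survive. -/
theorem tendsto_error_exponent {d : ℕ} (hd : 0 < d) (c : ℝ) {ξ : ℝ} (hξ : 0 < ξ) {τ : ℕ → ℝ}
    (hτ : Tendsto τ atTop atTop) {s s' : ℝ} (hs : 0 < s) (hs' : 0 < s') (δ L₁ L₂ : ℝ)
    {σ σ' : ℝ} (hσ : 0 < σ) (hσ' : 0 < σ') :
    Tendsto (fun t : ℕ => (δ - L₁ * (radius d c ξ ⌊s * τ t⌋₊ + radius d c ξ ⌊s' * τ t⌋₊)) ^ 2 /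
        (2 * ((σ + L₂ * radius d c ξ ⌊s * τ t⌋₊) ^ 2 / ⌊s * τ t⌋₊ +
          (σ' + L₂ * radius d c ξ ⌊s' * τ t⌋₊) ^ 2 / ⌊s' * τ t⌋₊)) / τ t) atTop
      (𝓝 (δ ^ 2 / (2 * (σ ^ 2 / s + σ' ^ 2 / s')))) := by
  have r := (tendsto_radius hd c hξ).comp (tendsto_floor_atTop hτ hs)
  have r' := (tendsto_radius hd c hξ).comp (tendsto_floor_atTop hτ hs')
  have k := tendsto_floor_div hτ hs.le
  have k' := tendsto_floor_div hτ hs'.le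
  have h1 := ((((r.add r').const_mul L₁).const_sub δ).pow 2).div
    (((((r.const_mul L₂).const_add σ).pow 2).div k hs.ne').add
      ((((r'.const_mul L₂).const_add σ').pow 2).div k' hs'.ne') |>.const_mul 2) (by
        simp only [mul_zero, add_zero]; positivity)
  simp only [mul_zero, add_zero, sub_zero] at h1
  refine Tendsto.congr' ?_ h1
  filter_upwards [hτ.eventually_gt_atTop 0] with t ht
  simp only [Function.comp, Pi.div_apply]
  rw [div_div, div_div_eq_mul_div, div_div_eq_mul_div, mul_assoc, add_mul, div_mul_eq_mul_div,
    div_mul_eq_mul_div]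

end SNE

namespace SNE

/-! ## The convergence rate -/

section Rate

set_option linter.unusedSectionVars false

variable {χ : Type*} {d : ℕ} {Y : Set (EuclideanSpace ℝ (Fin d))} {c ξ : ℝ}
  [Finite χ]
  {f σ a : χ → EuclideanSpace ℝ (Fin d) → ℝ}

/-- The Lambert factor `-W₋₁(-exp (-ζ - 1))` that appears in the rate. -/
noncomputable def lambertFactor (z : ℝ) : ℝ := -lambertWNegOne (-Real.exp (-z - 1))

/-- The number `s` such that the balance between activation and estimation errors is attained for
the `m`-sets with `m ≈ s * t ^ (1 / (1 + ξ))`. -/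
noncomputable def balance (C ξ z b : ℝ) : ℝ := (b * C / lambertFactor z) ^ (1 / (1 + ξ))

theorem balance_pos {C z b : ℝ} (hC : 0 < C) (hz : 0 ≤ z) (hb : 0 < b) :
    0 < balance C ξ z b := by
  have h1 : 1 ≤ lambertFactor z := (neg_lambertWNegOne_spec hz).1
  exact Real.rpow_pos_of_pos (by positivity) _

/-- This is the defining relation `s ^ (1 + ξ) = b C / u` rearranged: at the balance, the expected
number of hits is asymptotically `u` times the number required, `u` being the Lambert factor. -/
theorem mul_rpow_neg_balance (hξ : 0 < ξ) {C z b : ℝ} (hC : 0 < C) (hz : 0 ≤ z) (hb : 0 < b) :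
    b * (C * balance C ξ z b ^ (-ξ)) = balance C ξ z b * lambertFactor z := by
  have h1 : 1 ≤ lambertFactor z := (neg_lambertWNegOne_spec hz).1
  have h2 : 0 < b * C / lambertFactor z := by positivity
  have hs := balance_pos (ξ := ξ) hC hz hb
  have e : balance C ξ z b ^ ξ * balance C ξ z b = b * C / lambertFactor z := by
    rw [← Real.rpow_add_one hs.ne', balance, ← Real.rpow_mul h2.le, add_comm ξ 1,
      one_div_mul_cancel (by positivity), Real.rpow_one]
  rw [Real.rpow_neg hs.le]
  have h3 := (Real.rpow_pos_of_pos hs ξ).ne'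
  rw [eq_div_iff (by positivity)] at e
  field_simp
  linarith

/-- At the balance, the exponent of the activation probability equals `s * ζ`. -/
theorem activation_exponent_balance (hξ : 0 < ξ) {C z b : ℝ} (hC : 0 < C) (hz : 0 ≤ z)
    (hb : 0 < b) :
    b * (C * balance C ξ z b ^ (-ξ)) * (1 - Real.exp (-Real.log (lambertFactor z))) -
      balance C ξ z b * Real.log (lambertFactor z) = z * balance C ξ z b := by
  obtain ⟨h1, h2⟩ := neg_lambertWNegOne_spec hz
  change 1 ≤ lambertFactor z at h1
  change lambertFactor z - 1 - Real.log (lambertFactor z) = z at h2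
  -- The value `θ = log u` maximizes the Chernoff exponent `s u (1 - exp (-θ)) - s θ`; the maximum
  -- is `s (u - 1 - log u)`.
  rw [mul_rpow_neg_balance hξ hC hz hb, Real.exp_neg, Real.exp_log (by positivity)]
  have e : balance C ξ z b * lambertFactor z * (1 - (lambertFactor z)⁻¹) =
      balance C ξ z b * (lambertFactor z - 1) := by
    field_simp
  rw [e]
  linear_combination balance C ξ z b * h2

theorem zeta_self (xs : χ) (y : EuclideanSpace ℝ (Fin d)) : zeta f σ xs y xs =
    ((⨅ x' : {x' : χ // x' ≠ xs}, f x' y) - f xs y) ^ 2 / (4 * σ xs y ^ 2) := by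
  simp [zeta]

theorem zeta_of_ne {x xs : χ} (hx : x ≠ xs) (y : EuclideanSpace ℝ (Fin d)) :
    zeta f σ xs y x = (f x y - f xs y) ^ 2 / (4 * σ x y ^ 2) := by
  simp [zeta, hx]

theorem ciInf_sub_pos [Nontrivial χ] {xs : χ} {y : EuclideanSpace ℝ (Fin d)}
    (hxs : ∀ x, x ≠ xs → f xs y < f x y) :
    0 < (⨅ x' : {x' : χ // x' ≠ xs}, f x' y) - f xs y := by
  obtain ⟨x, hx⟩ := exists_ne xs
  have : Nonempty {x' : χ // x' ≠ xs} := ⟨⟨x, hx⟩⟩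
  obtain ⟨i, hi⟩ := exists_eq_ciInf_of_finite (f := fun x' : {x' : χ // x' ≠ xs} => f x' y)
  rw [← hi]
  exact sub_pos.2 (hxs i i.2)

theorem ciInf_sub_le {x xs : χ} (hx : x ≠ xs) (y : EuclideanSpace ℝ (Fin d)) :
    (⨅ x' : {x' : χ // x' ≠ xs}, f x' y) - f xs y ≤ f x y - f xs y :=
  sub_le_sub_right (ciInf_le (f := fun x' : {x' : χ // x' ≠ xs} => f x' y)
    (Set.finite_range _).bddBelow ⟨x, hx⟩) _

theorem zeta_pos [Nontrivial χ] {xs : χ} {y : EuclideanSpace ℝ (Fin d)}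
    (hxs : ∀ x, x ≠ xs → f xs y < f x y) (hσ : ∀ x, 0 < σ x y) (x : χ) :
    0 < zeta f σ xs y x := by
  have := hσ x
  by_cases hx : x = xs
  · subst hx
    have := ciInf_sub_pos hxs
    rw [zeta_self]; positivity
  · have := sub_pos.2 (hxs x hx)
    rw [zeta_of_ne hx]; positivity

/-- Once `C ^ (1 / (1 + ξ))` is moved inside the minimum, its terms are the balanced exponents `ζ_x
s_x`. Attainment on the finite `χ` serves to show positivity. -/
theorem rate_eq [Nonempty χ] {xs : χ} {y : EuclideanSpace ℝ (Fin d)} (hc : 0 < c)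
    (hz : ∀ x, 0 < zeta f σ xs y x) (ha : ∀ x, 0 < a x y) :
    (∀ x, rate c ξ f σ a xs y ≤
      zeta f σ xs y x * balance (volConst d c) ξ (zeta f σ xs y x) (a x y)) ∧
    ∃ x, rate c ξ f σ a xs y =
      zeta f σ xs y x * balance (volConst d c) ξ (zeta f σ xs y x) (a x y) := by
  have hC := volConst_pos d hc
  have e : ∀ x, volConst d c ^ (1 / (1 + ξ)) * (zeta f σ xs y x *
      (-lambertWNegOne (-Real.exp (-zeta f σ xs y x - 1))) ^ (-(1 / (1 + ξ))) *
      a x y ^ (1 / (1 + ξ))) =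
      zeta f σ xs y x * balance (volConst d c) ξ (zeta f σ xs y x) (a x y) := by
    intro x
    have h1 : 1 ≤ lambertFactor (zeta f σ xs y x) := (neg_lambertWNegOne_spec (hz x).le).1
    change _ * (_ * lambertFactor (zeta f σ xs y x) ^ (-(1 / (1 + ξ))) * _) = _
    rw [balance, Real.div_rpow (by have := ha x; positivity) (by positivity),
      Real.mul_rpow (ha x).le hC.le, Real.rpow_neg (by positivity)]
    ring
  constructor
  · intro x
    rw [← e x, rate]
    exact mul_le_mul_of_nonneg_left (ciInf_le (Set.finite_range _).bddBelow x) (by positivity)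
  · obtain ⟨x, hx⟩ := exists_eq_ciInf_of_finite (f := fun x => zeta f σ xs y x *
      (-lambertWNegOne (-Real.exp (-zeta f σ xs y x - 1))) ^ (-(1 / (1 + ξ))) *
      a x y ^ (1 / (1 + ξ)))
    exact ⟨x, by rw [← e x, rate, ← hx]⟩

theorem rate_pos [Nonempty χ] {xs : χ} {y : EuclideanSpace ℝ (Fin d)} (hc : 0 < c)
    (hz : ∀ x, 0 < zeta f σ xs y x) (ha : ∀ x, 0 < a x y) : 0 < rate c ξ f σ a xs y := by
  obtain ⟨x, hx⟩ := (rate_eq (c := c) (ξ := ξ) hc hz ha).2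
  rw [hx]
  exact mul_pos (hz x) (balance_pos (volConst_pos d hc) (hz x).le (ha x))

/-- The exponent of the Gaussian error bound dominates the smaller of the two balanced
exponents. -/
theorem lt_error_exponent [Nontrivial χ] {x xs : χ} {y : EuclideanSpace ℝ (Fin d)}
    (hxs : ∀ x, x ≠ xs → f xs y < f x y) (hσ : ∀ x, 0 < σ x y) (hx : x ≠ xs)
    {h s s' : ℝ} (hs : 0 < s) (hs' : 0 < s') (h1 : h < zeta f σ xs y x * s)
    (h2 : h < zeta f σ xs y xs * s') :
    h < (f x y - f xs y) ^ 2 / (2 * (σ x y ^ 2 / s + σ xs y ^ 2 / s')) := by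
  have p1 := hσ x
  have p2 := hσ xs
  have hδ := ciInf_sub_pos hxs
  rw [zeta_of_ne hx, div_mul_eq_mul_div, lt_div_iff₀ (by positivity)] at h1
  rw [zeta_self, div_mul_eq_mul_div, lt_div_iff₀ (by positivity)] at h2
  have h3 := pow_le_pow_left₀ hδ.le (ciInf_sub_le (f := f) hx y) 2
  have h4 : h * (4 * σ xs y ^ 2) < (f x y - f xs y) ^ 2 * s' :=
    h2.trans_le (mul_le_mul_of_nonneg_right h3 hs'.le)
  rw [lt_div_iff₀ (by positivity)]
  have h5 : h * (4 * σ x y ^ 2) / s < (f x y - f xs y) ^ 2 := by rwa [div_lt_iff₀ hs]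
  have h6 : h * (4 * σ xs y ^ 2) / s' < (f x y - f xs y) ^ 2 := by rwa [div_lt_iff₀ hs']
  -- The `4` in `ζ`, against the `2` of the Gaussian tail, makes the target an average of the two
  -- bounds `h5` and `h6`.
  have e : h * (2 * (σ x y ^ 2 / s + σ xs y ^ 2 / s')) =
      (h * (4 * σ x y ^ 2) / s + h * (4 * σ xs y ^ 2) / s') / 2 := by ring
  rw [e]
  linarith

variable [MeasurableSpace χ] [MeasurableSingletonClass χ]
  {Ω : Type*} [MeasurableSpace Ω] {P : Measure Ω} [IsProbabilityMeasure P]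
  {X : ℕ → Ω → χ} {V : ℕ → Ω → EuclideanSpace ℝ (Fin d)} {ε : ℕ → Ω → ℝ}

theorem eventually_measure_Psi_lt_le (hs : IsStaticSampling P Y a σ X V ε) (hd : 0 < d)
    (hc : 0 < c) (hξ : 0 < ξ) {x : χ} (ha_cont : ContinuousOn (a x) (interior Y))
    {y : EuclideanSpace ℝ (Fin d)} (hy : y ∈ interior Y) (ha : 0 < a x y) {z h : ℝ} (hz : 0 ≤ z)
    (hh : h < z * balance (volConst d c) ξ z (a x y)) :
    ∀ᶠ t : ℕ in atTop, P {ω | Psi Y c ξ (fun i => X i ω) (fun i => V i ω) t x y <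
        ⌊balance (volConst d c) ξ z (a x y) * (t : ℝ) ^ (1 / (1 + ξ))⌋₊} ≤
      ENNReal.ofReal (Real.exp (-(h * (t : ℝ) ^ (1 / (1 + ξ))))) := by
  have hC := volConst_pos d hc
  have hs0 := balance_pos (ξ := ξ) hC hz ha
  have hτ := tendsto_stage_rpow_atTop hξ
  rw [← activation_exponent_balance hξ hC hz ha] at hh
  set s := balance (volConst d c) ξ z (a x y)
  have hθ : 0 ≤ Real.log (lambertFactor z) := Real.log_nonneg (neg_lambertWNegOne_spec hz).1
  set θ := Real.log (lambertFactor z)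
  -- The strict inequality for the exponent leaves room to replace `a x y` by a slightly smaller
  -- `b`, which by continuity bounds the density from below on all small balls around `y`.
  obtain ⟨b, hb0, hba, hb⟩ : ∃ b, 0 < b ∧ b < a x y ∧
      h < b * (volConst d c * s ^ (-ξ)) * (1 - Real.exp (-θ)) - s * θ := by
    have hcont : Continuous fun b : ℝ =>
        b * (volConst d c * s ^ (-ξ)) * (1 - Real.exp (-θ)) - s * θ := by fun_prop
    have h1 := (hcont.tendsto (a x y)).eventually (lt_mem_nhds hh)
    have h2 : ∀ᶠ b in 𝓝 (a x y), 0 < b := lt_mem_nhds ha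
    have h3 : ∀ᶠ b in 𝓝[<] (a x y), b < a x y := self_mem_nhdsWithin
    obtain ⟨b, hb⟩ := ((h1.filter_mono nhdsWithin_le_nhds).and
      ((h2.filter_mono nhdsWithin_le_nhds).and h3)).exists
    exact ⟨b, hb.2.1, hb.2.2, hb.1⟩
  have hnhds : ∀ᶠ v in 𝓝 y, v ∈ interior Y ∧ b ≤ a x v := by
    have hU := isOpen_interior.mem_nhds hy
    filter_upwards [hU, (ha_cont.continuousAt hU).eventually (lt_mem_nhds hba)] with v h1 h2
    exact ⟨h1, h2.le⟩
  obtain ⟨r, hr, hball⟩ := Metric.eventually_nhds_iff_ball.1 hnhds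
  have hrad := ((tendsto_radius hd c hξ).comp (tendsto_floor_atTop hτ hs0)).eventually
    (gt_mem_nhds hr)
  filter_upwards [hrad, eventually_exp_neg_le hτ
    (tendsto_activation_exponent hξ hs0 b (volConst d c) (1 - Real.exp (-θ)) θ) hb] with t h1 h2
  refine (measure_Psi_lt_le hs hd hc.le hb0.le (fun v hv => hball v ?_) hθ t).trans
    (ENNReal.ofReal_le_ofReal h2)
  exact Metric.ball_subset_ball h1.le hv

theorem eventually_measure_error_le [Nontrivial χ] (hs : IsStaticSampling P Y a σ X V ε)
    (hd : 0 < d) (hc : 0 < c) (hξ : 0 < ξ) {L₁ L₂ : ℝ≥0}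
    (hf_lip : ∀ x, LipschitzOnWith L₁ (f x) Y) (hσ_pos : ∀ x, ∀ y ∈ Y, 0 < σ x y)
    (hσ_lip : ∀ x, LipschitzOnWith L₂ (σ x) Y)
    (ha_cont : ∀ x, ContinuousOn (a x) (interior Y)) {y : EuclideanSpace ℝ (Fin d)} (hy : y ∈ Y)
    {x xs : χ} (hxs : ∀ x, x ≠ xs → f xs y < f x y) (hx : x ≠ xs) {h s s' : ℝ} (hs0 : 0 < s)
    (hs0' : 0 < s') (h1 : h < zeta f σ xs y x * s) (h2 : h < zeta f σ xs y xs * s') :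
    ∀ᶠ t : ℕ in atTop, P {ω |
        ⌊s * (t : ℝ) ^ (1 / (1 + ξ))⌋₊ ≤ Psi Y c ξ (fun i => X i ω) (fun i => V i ω) t x y ∧
        ⌊s' * (t : ℝ) ^ (1 / (1 + ξ))⌋₊ ≤ Psi Y c ξ (fun i => X i ω) (fun i => V i ω) t xs y ∧
        estimate Y c ξ (fun i => X i ω) (fun i => V i ω)
            (fun i => f (X i ω) (V i ω) + ε i ω) t x y ≤
          estimate Y c ξ (fun i => X i ω) (fun i => V i ω)
            (fun i => f (X i ω) (V i ω) + ε i ω) t xs y} ≤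
      ENNReal.ofReal (Real.exp (-(h * (t : ℝ) ^ (1 / (1 + ξ))))) := by
  have hτ := tendsto_stage_rpow_atTop hξ
  have hlt := lt_error_exponent hxs (fun x => hσ_pos x y hy) hx hs0 hs0' h1 h2
  have r := (tendsto_radius hd c hξ).comp (tendsto_floor_atTop hτ hs0)
  have r' := (tendsto_radius hd c hξ).comp (tendsto_floor_atTop hτ hs0')
  have hΔ := ((r.add r').const_mul (L₁ : ℝ)).const_sub (f x y - f xs y)
  simp only [mul_zero, add_zero, sub_zero] at hΔ
  filter_upwards [(tendsto_floor_atTop hτ hs0).eventually_ge_atTop 1,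
    (tendsto_floor_atTop hτ hs0').eventually_ge_atTop 1,
    hΔ.eventually (lt_mem_nhds (sub_pos.2 (hxs x hx))),
    eventually_exp_neg_le hτ (tendsto_error_exponent hd c hξ hτ hs0 hs0' (f x y - f xs y) L₁ L₂
      (hσ_pos x y hy) (hσ_pos xs y hy)) hlt] with t k1 k2 hpos hexp
  refine (measure_estimate_le_le hs hc.le hξ.le hf_lip hσ_pos hσ_lip ha_cont hy hx k1 k2 t
    hpos.le).trans (ENNReal.ofReal_le_ofReal ?_)
  rw [neg_div]
  exact hexp

/-- The probability of a wrong decision decays at every exponential rate below `rate`. -/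
theorem eventually_measure_ne_le [Nontrivial χ] (hs : IsStaticSampling P Y a σ X V ε)
    (hd : 0 < d) (hc : 0 < c) (hξ : 0 < ξ) {L₁ L₂ : ℝ≥0}
    (hf_lip : ∀ x, LipschitzOnWith L₁ (f x) Y) (hσ_pos : ∀ x, ∀ y ∈ Y, 0 < σ x y)
    (hσ_lip : ∀ x, LipschitzOnWith L₂ (σ x) Y)
    (ha_pos : ∀ x, ∀ y ∈ interior Y, 0 < a x y)
    (ha_cont : ∀ x, ContinuousOn (a x) (interior Y))
    {xhat : ℕ → EuclideanSpace ℝ (Fin d) → Ω → χ}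
    (hxhat : IsEstimatedOptimum Y c ξ f X V ε xhat)
    {y : EuclideanSpace ℝ (Fin d)} (hy : y ∈ interior Y)
    {xs : χ} (hxs : ∀ x, x ≠ xs → f xs y < f x y) {h : ℝ} (hh : h < rate c ξ f σ a xs y) :
    ∀ᶠ t : ℕ in atTop, P {ω | xhat t y ω ≠ xs} ≤
      ENNReal.ofReal (2 * Nat.card χ * Real.exp (-(h * (t : ℝ) ^ (1 / (1 + ξ))))) := by
  have := Fintype.ofFinite χ
  have hyY := interior_subset hy
  have hz := zeta_pos hxs (fun x => hσ_pos x y hyY)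
  have ha := fun x => ha_pos x y hy
  have hrate : ∀ x, h < zeta f σ xs y x * balance (volConst d c) ξ (zeta f σ xs y x) (a x y) :=
    fun x => hh.trans_le ((rate_eq hc hz ha).1 x)
  set s : χ → ℝ := fun x => balance (volConst d c) ξ (zeta f σ xs y x) (a x y) with hsdef
  have hs0 : ∀ x, 0 < s x := fun x => balance_pos (volConst_pos d hc) (hz x).le (ha x)
  have hτ := tendsto_stage_rpow_atTop hξ
  have ev1 := eventually_all.2 fun x =>
    eventually_measure_Psi_lt_le hs hd hc hξ (ha_cont x) hy (ha x) (hz x).le (hrate x)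
  have ev2 : ∀ᶠ t : ℕ in atTop, ∀ x, x ≠ xs → P {ω |
        ⌊s x * (t : ℝ) ^ (1 / (1 + ξ))⌋₊ ≤ Psi Y c ξ (fun i => X i ω) (fun i => V i ω) t x y ∧
        ⌊s xs * (t : ℝ) ^ (1 / (1 + ξ))⌋₊ ≤ Psi Y c ξ (fun i => X i ω) (fun i => V i ω) t xs y ∧
        estimate Y c ξ (fun i => X i ω) (fun i => V i ω)
            (fun i => f (X i ω) (V i ω) + ε i ω) t x y ≤
          estimate Y c ξ (fun i => X i ω) (fun i => V i ω)
            (fun i => f (X i ω) (V i ω) + ε i ω) t xs y} ≤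
      ENNReal.ofReal (Real.exp (-(h * (t : ℝ) ^ (1 / (1 + ξ))))) := by
    refine eventually_all.2 fun x => ?_
    by_cases hx : x = xs
    · exact Eventually.of_forall fun t h => absurd hx h
    · filter_upwards [eventually_measure_error_le hs hd hc hξ hf_lip hσ_pos hσ_lip ha_cont hyY hxs
        hx (hs0 x) (hs0 xs) (hrate x) (hrate xs)] with t ht _ using ht
  -- Cutoffs of at least `1` guarantee that all estimates exist once the cutoffs are reached, so
  -- that `xhat` really is a minimizer.
  have ev3 := eventually_all.2 fun x => (tendsto_floor_atTop hτ (hs0 x)).eventually_ge_atTop 1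
  filter_upwards [ev1, ev2, ev3] with t h1 h2 h3
  set A : χ → Set Ω := fun x => {ω | Psi Y c ξ (fun i => X i ω) (fun i => V i ω) t x y <
    ⌊s x * (t : ℝ) ^ (1 / (1 + ξ))⌋₊}
  set B : χ → Set Ω := fun x => {ω | x ≠ xs ∧
    (⌊s x * (t : ℝ) ^ (1 / (1 + ξ))⌋₊ ≤ Psi Y c ξ (fun i => X i ω) (fun i => V i ω) t x y ∧
        ⌊s xs * (t : ℝ) ^ (1 / (1 + ξ))⌋₊ ≤ Psi Y c ξ (fun i => X i ω) (fun i => V i ω) t xs y ∧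
        estimate Y c ξ (fun i => X i ω) (fun i => V i ω)
            (fun i => f (X i ω) (V i ω) + ε i ω) t x y ≤
          estimate Y c ξ (fun i => X i ω) (fun i => V i ω)
            (fun i => f (X i ω) (V i ω) + ε i ω) t xs y)}
  have hsub : {ω | xhat t y ω ≠ xs} ⊆ ⋃ x, A x ∪ B x := by
    intro ω hω
    by_cases hA : ∃ x, ω ∈ A x
    · obtain ⟨x, hx⟩ := hA
      exact Set.mem_iUnion.2 ⟨x, Or.inl hx⟩
    · have hΨ : ∀ x, ⌊s x * (t : ℝ) ^ (1 / (1 + ξ))⌋₊ ≤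
          Psi Y c ξ (fun i => X i ω) (fun i => V i ω) t x y := fun x =>
        not_lt.1 fun hlt => hA ⟨x, hlt⟩
      exact Set.mem_iUnion.2 ⟨xhat t y ω, Or.inr ⟨hω, hΨ _, hΨ _,
        hxhat.minimizes t y hy ω (fun x => (h3 x).trans (hΨ x)) xs⟩⟩
  have hB : ∀ x, P (B x) ≤ ENNReal.ofReal (Real.exp (-(h * (t : ℝ) ^ (1 / (1 + ξ))))) := by
    intro x
    by_cases hx : x = xs
    · have : B x = ∅ := by ext ω; simp [B, hx]
      rw [this, measure_empty]; exact zero_le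
    · exact (measure_mono fun ω hω => hω.2).trans (h2 x hx)
  refine (measure_mono hsub).trans ((measure_iUnion_fintype_le _ _).trans ?_)
  -- Each decision contributes at most one activation failure and one wrong comparison, hence the
  -- factor `2 * Nat.card χ`.
  calc _ ≤ ∑ _x : χ, 2 * ENNReal.ofReal (Real.exp (-(h * (t : ℝ) ^ (1 / (1 + ξ))))) := by
        refine Finset.sum_le_sum fun x _ => ?_
        rw [two_mul]
        exact (measure_union_le _ _).trans (add_le_add (h1 x) (hB x))
    _ = _ := by
        rw [Finset.sum_const, Finset.card_univ, nsmul_eq_mul, ENNReal.ofReal_mul (by positivity),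
          ENNReal.ofReal_mul (by norm_num), ENNReal.ofReal_natCast, Nat.card_eq_fintype_card,
          ENNReal.ofReal_ofNat]
        ring

/-! ### From error probabilities to the expected loss -/

/-- A correct decision has loss `ρ u u = 0`, and a wrong one has one of finitely many losses. The
summand `1` in the constant keeps it positive, so that its logarithm can be taken later. -/
theorem exists_expectedLoss_le {ρ : ℝ → ℝ → ℝ} (hρ : IsMetric ρ)
    (xs : χ) (y : EuclideanSpace ℝ (Fin d)) :
    ∃ M : ℝ, 0 < M ∧ ∀ D : Ω → χ, Measurable D →
      expectedLoss P ρ f D xs y ≤ ENNReal.ofReal M * P {ω | D ω ≠ xs} := by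
  have := Fintype.ofFinite χ
  refine ⟨∑ x, |ρ (f x y) (f xs y)| + 1, by positivity, fun D hD => ?_⟩
  have hm : MeasurableSet {ω | D ω ≠ xs} := (hD (measurableSet_singleton xs)).compl
  rw [← lintegral_indicator_const hm, expectedLoss]
  refine lintegral_mono fun ω => ?_
  by_cases h : D ω = xs
  · simp [h, (hρ.eq_zero_iff _ _).2 rfl]
  · rw [Set.indicator_of_mem (show ω ∈ {ω | D ω ≠ xs} from h)]
    refine ENNReal.ofReal_le_ofReal ?_
    have := Finset.single_le_sum (f := fun x => |ρ (f x y) (f xs y)|)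
      (fun x _ => abs_nonneg _) (Finset.mem_univ (D ω))
    have h2 := le_abs_self (ρ (f (D ω) y) (f xs y))
    linarith

end Rate

/-- A sequence that is eventually below `M * exp (-h * τ)` tends to zero when `h > 0`. -/
theorem tendsto_zero_of_le_exp {τ : ℕ → ℝ} (hτ : Tendsto τ atTop atTop) {u : ℕ → ℝ≥0∞} {h M : ℝ}
    (hh : 0 < h) (hu : ∀ᶠ t in atTop, u t ≤ ENNReal.ofReal (M * Real.exp (-(h * τ t)))) :
    Tendsto u atTop (𝓝 0) := by
  have h1 : Tendsto (fun t => M * Real.exp (-(h * τ t))) atTop (𝓝 (M * 0)) :=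
    (Real.tendsto_exp_neg_atTop_nhds_zero.comp (hτ.const_mul_atTop hh)).const_mul M
  have h2 := ENNReal.tendsto_ofReal h1
  rw [mul_zero, ENNReal.ofReal_zero] at h2
  exact tendsto_of_tendsto_of_tendsto_of_le_of_le' tendsto_const_nhds h2
    (Eventually.of_forall fun _ => zero_le) hu

/-- Exponential upper bounds at every rate below `R` give a lower bound for the logarithmic rate
of decay. -/
theorem le_liminf_neg_log {τ : ℕ → ℝ} (hτ : Tendsto τ atTop atTop) {u : ℕ → ℝ≥0∞} {R M : ℝ}
    (hM : 0 < M)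
    (hu : ∀ h < R, ∀ᶠ t in atTop, u t ≤ ENNReal.ofReal (M * Real.exp (-(h * τ t)))) :
    (R : EReal) ≤ liminf (fun t => ((-(1 / τ t) : ℝ) : EReal) * ENNReal.log (u t)) atTop := by
  refine EReal.ge_of_forall_gt_iff_ge.1 fun h hh => ?_
  have hh' : h < R := EReal.coe_lt_coe_iff.1 hh
  -- The room between `h` and `h₂` absorbs the term `log M / τ t`, which tends to zero.
  obtain ⟨h₂, hh2, hR⟩ := exists_between hh'
  have hlim : Tendsto (fun t => h₂ - Real.log M / τ t) atTop (𝓝 (h₂ - 0)) :=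
    (hτ.const_div_atTop _).const_sub h₂
  rw [sub_zero] at hlim
  refine le_liminf_of_le (by isBoundedDefault) ?_
  filter_upwards [hu h₂ hR, hlim.eventually (lt_mem_nhds hh2), hτ.eventually_gt_atTop 0]
    with t h1 h2 h3
  -- Monotonicity of the extended logarithm also covers `u t = 0`, where the logarithm is `⊥` and
  -- its product with a negative number is `⊤`.
  have h4 : ENNReal.log (u t) ≤ ((Real.log M - h₂ * τ t : ℝ) : EReal) := by
    refine (ENNReal.log_le_log h1).trans (le_of_eq ?_)
    rw [ENNReal.log_ofReal_of_pos (by positivity), Real.log_mul hM.ne' (Real.exp_pos _).ne',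
      Real.log_exp]
    rfl
  have h5 : ((-(1 / τ t) : ℝ) : EReal) ≤ 0 := by
    have : -(1 / τ t) ≤ 0 := neg_nonpos.2 (by positivity)
    exact_mod_cast this
  have h6 := EReal.mul_le_mul_of_nonpos_right h4 h5
  rw [mul_comm _ (ENNReal.log (u t))]
  refine le_trans ?_ h6
  rw [← EReal.coe_mul, EReal.coe_le_coe_iff]
  have e : (Real.log M - h₂ * τ t) * -(1 / τ t) = h₂ - Real.log M / τ t := by
    field_simp
    ring
  rw [e]
  exact h2.le

end SNE

theorem theorem3 {χ : Type*} [Finite χ] [Nontrivial χ] [MeasurableSpace χ]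
    [MeasurableSingletonClass χ]
    {d : ℕ} (hd : 0 < d) (Y : Set (EuclideanSpace ℝ (Fin d))) (hY : Bornology.IsBounded Y)
    (c ξ : ℝ) (hc : 0 < c) (hξ : 0 < ξ)
    (f σ a : χ → EuclideanSpace ℝ (Fin d) → ℝ) (L₁ L₂ : ℝ≥0)
    (hf_bdd : ∃ M : ℝ, ∀ x, ∀ y ∈ Y, |f x y| ≤ M)
    (hf_lip : ∀ x, LipschitzOnWith L₁ (f x) Y)
    (hσ_pos : ∀ x, ∀ y ∈ Y, 0 < σ x y)
    (hσ_lip : ∀ x, LipschitzOnWith L₂ (σ x) Y)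
    (ha_pos : ∀ x, ∀ y ∈ interior Y, 0 < a x y)
    (ha_cont : ∀ x, ContinuousOn (a x) (interior Y))
    {Ω : Type*} [MeasurableSpace Ω] (P : Measure Ω) [IsProbabilityMeasure P]
    (X : ℕ → Ω → χ) (V : ℕ → Ω → EuclideanSpace ℝ (Fin d)) (ε : ℕ → Ω → ℝ)
    (hsamp : SNE.IsStaticSampling P Y a σ X V ε)
    (xhat : ℕ → EuclideanSpace ℝ (Fin d) → Ω → χ)
    (hxhat : SNE.IsEstimatedOptimum Y c ξ f X V ε xhat)
    (ρ : ℝ → ℝ → ℝ) (hρ : SNE.IsMetric ρ)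
    (y : EuclideanSpace ℝ (Fin d)) (hy : y ∈ interior Y)
    (xs : χ) (hxs : ∀ x, x ≠ xs → f xs y < f x y) :
    Tendsto (fun t : ℕ => SNE.expectedLoss P ρ f (xhat t y) xs y) atTop (𝓝 0) ∧
    0 < SNE.rate c ξ f σ a xs y ∧
    ((SNE.rate c ξ f σ a xs y : ℝ) : EReal) ≤
      liminf (fun t : ℕ =>
        ((-(1 / (t : ℝ) ^ (1 / (1 + ξ))) : ℝ) : EReal) *
          ENNReal.log (SNE.expectedLoss P ρ f (xhat t y) xs y)) atTop := by
  have hyY := interior_subset hy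
  have hz := SNE.zeta_pos hxs fun x => hσ_pos x y hyY
  have hrate : 0 < SNE.rate c ξ f σ a xs y :=
    SNE.rate_pos hc hz fun x => ha_pos x y hy
  have hτ := SNE.tendsto_stage_rpow_atTop hξ
  obtain ⟨M, hM, hloss⟩ := SNE.exists_expectedLoss_le (P := P) (f := f) hρ xs y
  have hcard : 0 < Nat.card χ := Nat.card_pos
  have hbound : ∀ h < SNE.rate c ξ f σ a xs y, ∀ᶠ t : ℕ in atTop,
      SNE.expectedLoss P ρ f (xhat t y) xs y ≤ ENNReal.ofReal
        (M * (2 * Nat.card χ) * Real.exp (-(h * (t : ℝ) ^ (1 / (1 + ξ))))) := by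
    intro h hh
    filter_upwards [SNE.eventually_measure_ne_le hsamp hd hc hξ hf_lip hσ_pos hσ_lip ha_pos
      ha_cont hxhat hy hxs hh] with t ht
    refine (hloss _ (hxhat.measurable t y)).trans ?_
    rw [mul_assoc, ENNReal.ofReal_mul hM.le]
    gcongr
  refine ⟨SNE.tendsto_zero_of_le_exp hτ (half_pos hrate) (hbound _ (half_lt_self hrate)), hrate,
    SNE.le_liminf_neg_log hτ (by positivity) hbound⟩
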